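/- All graphs are finite and simple. Let $G$ be a connected graph and $v\in V(G)$, and let $G_v$ be the graph obtained from $G$ by adding a new vertex $v'$ adjacent to $v$ and to all neighbours of $v$ (a true twin of $v$). A search tree on a connected graph $H$ is a rooted tree with vertex set $V(H)$, defined recursively: its root is some $r\in V(H)$ and the children of $r$ are the roots of search trees on the connected components of $H-r$. If $b$ is a child of $a$ in a search tree $T$ on $H$, the rotation of $a$ and $b$ makes $b$ take the place of $a$ (as child of the parent of $a$, or as root), makes $a$ a child of $b$, moves to $a$ exactly those subtrees of $b$ that contain a vertex adjacent to $a$ in $H$, and leaves all other parents unchanged. The rotation graph $\mathcal R(H)$ has the search trees on $H$ as vertices, two of them being adjacent if they differ by one rotation. For a search tree $T$ on $G$ let $A_T=(a_0,\dots,a_{d_{T,v}}=v)$ be the path in $T$ from the root $a_0$ to $v$. For $0\le i\le d_{T,v}$ let $T(i,1)$ be the rooted tree obtained from $T$ by inserting $v'$ directly above $a_i$ (as a new root if $i=0$, by subdividing the edge $a_{i-1}a_i$ if $i\ge 1$), and let $T(i,2)$ be obtained from $T(i,1)$ by exchanging $v$ and $v'$. Put $P(T)=\{T(i,j)\mid 0\le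 i\le d_{T,v},\ j\in\{1,2\}\}$, and let $E(P(T))$ be the edge set of the subgraph of $\mathcal R(G_v)$ induced by $P(T)$. For an edge $e=\{T,T'\}$ of $\mathcal R(G)$ let $\varepsilon_e$ be the set of the following pairs, for $j\in\{1,2\}$, where either of the two endpoints of $e$ may play the role of $T$, $T'$ is obtained from $T$ by the rotation of $a$ and its child $b$, and $k=d_{T,v}$: 1. if $a,b\notin A_T$: the pairs $\{T(i,j),T'(i,j)\}$ for $0\le i\le k$; 2. if $a=a_{l-1}$, $b=a_l$, $b\ne v$, and the subtree of $b$ in $T$ that contains $v$ has a vertex adjacent to $a$ in $G$: the pairs $\{T(i,j),T'(i,j)\}$ for $0\le i\le k$, $i\neq l$; 3. if $a=a_{l-1}$, $b=a_l$, $b\ne v$, and that subtree has no vertex adjacent to $a$ in $G$: the pairs $\{T(i,j),T'(i,j)\}$ for $0\le i\le l-1$ and $\{T(i+1,j),T'(i,j)\}$ for $l\le i\le k-1$; 4. if $b=v$: the pairs $\{T(i,j),T'(i,j)\}$ for $0\le i\le k-1$. Then: * the sets $P(T)$, for $T\in V(\mathcal R(G))$, form a partition of $V(\mathcal R(G_v))$: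 they are non-empty, pairwise disjoint for distinct $T$, and their union is $V(\mathcal R(G_v))$; * for every $T\in V(\mathcal R(G))$, the set $P(T)$ induces a path in $\mathcal R(G_v)$, with $2(d_{T,v}+1)$ vertices; * $\displaystyle E(\mathcal R(G_v))=\Bigl(\bigcup_{T\in V(\mathcal R(G))}E(P(T))\Bigr)\cup\Bigl(\bigcup_{e\in E(\mathcal R(G))}\varepsilon_e\Bigr).$ -/

import Mathlib

universe u

/-- A rooted tree with vertex set `V`, given by its root and its parent function.
The root is recorded as its own parent; every vertex reaches the root by taking parents.
(Mathlib's `RootedTree` bundles its own vertex type; here the vertex set `V` is prescribed.) -/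
@[ext]
structure RootedTreeOn (V : Type u) where
  root : V
  parent : V → V
  parent_root : parent root = root
  reaches_root : ∀ v, ∃ n : ℕ, parent^[n] v = root

namespace RootedTreeOn

variable {V W : Type u}

/-- `c` is a child of `p` in `T`. -/
def IsChild (T : RootedTreeOn V) (c p : V) : Prop :=
  c ≠ T.root ∧ T.parent c = p

/-- `a` lies on the path in `T` from the root to `v` (so `v` is an ancestor of itself).
Equivalently, `v` is a vertex of the subtree of `T` rooted at `a`. -/
def IsAncestor (T : RootedTreeOn V) (a v : V) : Prop :=
  ∃ n : ℕ, T.parent^[n] v = a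

open Classical in
/-- The level of `v` in `T`, that is, its distance from the root. -/
noncomputable def depth (T : RootedTreeOn V) (v : V) : ℕ :=
  Nat.find (T.reaches_root v)

/-- If `a₀, …, a_d` with `d = T.depth v` is the path in `T` from the root `a₀` to `a_d = v`,
then `T.pathVertex v i` is `a_i` for every `i ≤ d`. -/
noncomputable def pathVertex (T : RootedTreeOn V) (v : V) (i : ℕ) : V :=
  T.parent^[T.depth v - i] v

/-- The image of a rooted tree under a bijection of the vertex sets. -/
def map (f : V ≃ W) (T : RootedTreeOn V) : RootedTreeOn W where
  root := f T.root
  parent w := f (T.parent (f.symm w))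
  parent_root := by simp [T.parent_root]
  reaches_root := by
    intro w
    obtain ⟨n, hn⟩ := T.reaches_root (f.symm w)
    refine ⟨n, ?_⟩
    have h : ∀ m : ℕ, ∀ x : V,
        (fun w => f (T.parent (f.symm w)))^[m] (f x) = f (T.parent^[m] x) := by
      intro m
      induction m with
      | zero => intro x; rfl
      | succ m ih =>
        intro x
        rw [Function.iterate_succ_apply, Function.iterate_succ_apply, ← ih (T.parent x)]
        simp
    have h' := h n (f.symm w)
    rw [Equiv.apply_symm_apply, hn] at h'
    exact h'

open Classical in
/-- Insertion of the new vertex `none` directly above the vertex `a` of `T`.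
If `a` is not the root, the edge between `a` and its parent is subdivided by the new vertex;
if `a` is the root, the new vertex becomes the root and `T` is its only subtree. -/
noncomputable def insertAbove (T : RootedTreeOn V) (a : V) : RootedTreeOn (Option V) where
  root := if a = T.root then none else some T.root
  parent x :=
    match x with
    | none => if a = T.root then none else some (T.parent a)
    | some w => if w = a then none else some (T.parent w)
  parent_root := by
    by_cases h : a = T.root
    · simp [h]
    · have h' : T.root ≠ a := fun e => h e.symm
      simp [h, h', T.parent_root]
  reaches_root := by
    have key : ∀ n : ℕ, ∀ w : V, T.parent^[n] w = T.root → ∃ m : ℕ,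
        (fun x : Option V => match x with
          | none => if a = T.root then none else some (T.parent a)
          | some w => if w = a then none else some (T.parent w))^[m] (some w)
          = if a = T.root then none else some T.root := by
      intro n
      induction n with
      | zero =>
        intro w hw
        have hw' : w = T.root := hw
        subst hw'
        by_cases h : a = T.root
        · exact ⟨1, by simp [h]⟩
        · exact ⟨0, by simp [h]⟩
      | succ n ih =>
        intro w hw
        rw [Function.iterate_succ_apply] at hw
        obtain ⟨m, hm⟩ := ih _ hw
        by_cases hwa : w = a
        · subst hwa
          by_cases h : w = T.root
          · exact ⟨1, by simp [h]⟩
          · refine ⟨m + 2, ?_⟩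
            rw [Function.iterate_succ_apply, Function.iterate_succ_apply]
            simpa [h] using hm
        · refine ⟨m + 1, ?_⟩
          rw [Function.iterate_succ_apply]
          simpa [hwa] using hm
    intro x
    cases x with
    | none =>
      by_cases h : a = T.root
      · exact ⟨0, by simp [h]⟩
      · obtain ⟨n, hn⟩ := T.reaches_root (T.parent a)
        obtain ⟨m, hm⟩ := key n _ hn
        refine ⟨m + 1, ?_⟩
        rw [Function.iterate_succ_apply]
        simpa [h] using hm
    | some w =>
      obtain ⟨n, hn⟩ := T.reaches_root w
      exact key n w hn

end RootedTreeOn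

section SearchTrees

variable {V : Type u}

/-- `C` is the vertex set of a connected component of the subgraph of `G` induced by `S`. -/
def IsComponentOf (G : SimpleGraph V) (S C : Set V) : Prop :=
  ∃ c : (G.induce S).ConnectedComponent, C = Subtype.val '' c.supp

/-- `IsSearchTreeOn G T S r`: inside `T`, the vertex `r` is the root of a search tree on the
subgraph of `G` induced by `S`. This means that `r ∈ S` and that the children of `r` are the
roots `c C` of search trees on the connected components `C` of `G[S] - r`. -/
inductive IsSearchTreeOn (G : SimpleGraph V) (T : RootedTreeOn V) : Set V → V → Prop
  | node (S : Set V) (r : V) (c : Set V → V) (hr : r ∈ S)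
      (hchild : ∀ C, IsComponentOf G (S \ {r}) C → T.IsChild (c C) r)
      (hrec : ∀ C, IsComponentOf G (S \ {r}) C → IsSearchTreeOn G T C (c C)) :
      IsSearchTreeOn G T S r

/-- `T` is a search tree on `G`. -/
def IsSearchTree (G : SimpleGraph V) (T : RootedTreeOn V) : Prop :=
  IsSearchTreeOn G T Set.univ T.root

/-- The type of search trees on `G`. -/
abbrev SearchTree (G : SimpleGraph V) : Type u :=
  {T : RootedTreeOn V // IsSearchTree G T}

/-- `T'` is obtained from `T` by the rotation of `a` and its child `b`: `b` takes the place of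
`a`, `a` becomes a child of `b`, a subtree of `b` goes to `a` exactly if it has a vertex adjacent
to `a` in `G`, and all other vertices keep their parents. -/
structure IsRotation (G : SimpleGraph V) (T : RootedTreeOn V) (a b : V) (T' : RootedTreeOn V) :
    Prop where
  isChild : T.IsChild b a
  lower : T'.IsChild a b
  raise_of_root : a = T.root → T'.root = b
  raise_of_not_root : a ≠ T.root → T'.root = T.root ∧ T'.parent b = T.parent a
  moved : ∀ s, T.IsChild s b → (∃ y, T.IsAncestor s y ∧ G.Adj a y) → T'.parent s = a
  kept : ∀ s, s ≠ a → s ≠ b → ¬ (T.IsChild s b ∧ ∃ y, T.IsAncestor s y ∧ G.Adj a y) →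
    T'.parent s = T.parent s

/-- The rotation graph of `G`: its vertices are the search trees on `G`, and two of them are
adjacent if they differ by one rotation. -/
def rotationGraph (G : SimpleGraph V) : SimpleGraph (SearchTree G) :=
  SimpleGraph.fromRel fun T T' => ∃ a b, IsRotation G T.1 a b T'.1

end SearchTrees

section TrueTwins

variable {V : Type u}

/-- The graph obtained from `G` by adding a true twin `none` of `v`. -/
def addTrueTwin (G : SimpleGraph V) (v : V) : SimpleGraph (Option V) where
  Adj x y :=
    match x, y with
    | some a, some b => G.Adj a b
    | some a, none => G.Adj v a ∨ a = v
    | none, some b => G.Adj v b ∨ b = v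
    | none, none => False
  symm := by
    constructor
    intro x y h
    cases x <;> cases y <;> first | exact h | exact G.adj_symm h
  loopless := by
    constructor
    intro x h
    cases x with
    | none => exact h
    | some a => exact G.irrefl h

open Classical in
/-- The trees `T(i, 1)` (here `j = 0`) and `T(i, 2)` (here `j = 1`): the first is the insertion of
the twin `none` directly above the `i`-th vertex of the path in `T` from the root to `v`, and the
second is obtained from it by exchanging `v` and its twin. Meaningful for `i ≤ T.depth v`. -/
noncomputable def twinInsertion (T : RootedTreeOn V) (v : V) (i : ℕ) (j : Fin 2) :
    RootedTreeOn (Option V) :=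
  if j = 0 then T.insertAbove (T.pathVertex v i)
  else (T.insertAbove (T.pathVertex v i)).map (Equiv.swap (some v) none)

/-- The set `P(T)` of all `T(i, j)`. -/
def twinSet (T : RootedTreeOn V) (v : V) : Set (RootedTreeOn (Option V)) :=
  {R | ∃ i, i ≤ T.depth v ∧ ∃ j : Fin 2, R = twinInsertion T v i j}

/-- `E(P(T))`: the edges of the subgraph of the rotation graph of `G_v` induced by `P(T)`. -/
def twinSetEdges (G : SimpleGraph V) (v : V) (T : RootedTreeOn V) :
    Set (Sym2 (SearchTree (addTrueTwin G v))) :=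
  {f | f ∈ (rotationGraph (addTrueTwin G v)).edgeSet ∧ ∀ R ∈ f, R.1 ∈ twinSet T v}

/-- Let `T'` be obtained from `T` by the rotation of `a` and its child `b`, let `A` be the path in
`T` from the root to `v`, and let `k = T.depth v`.
`CrossAdj G v T T' R R'` lists the pairs `R ∈ P(T)`, `R' ∈ P(T')` that are joined:
* `off_path`: neither `a` nor `b` lies on `A`;
* `on_path_moved`, `on_path_kept_above`, `on_path_kept_below`: `a` and `b` lie on `A`, `b ≠ v`,
  `b` has level `l`, and the subtree of `b` that contains `v` does (respectively does not) have a
  vertex adjacent to `a`;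
* `at_twin`: `b = v`.
The case that `a` lies on `A` and `b` does not is that of the inverse rotation. -/
inductive CrossAdj (G : SimpleGraph V) (v : V) (T T' : RootedTreeOn V) :
    RootedTreeOn (Option V) → RootedTreeOn (Option V) → Prop
  | off_path (a b : V) (hrot : IsRotation G T a b T')
      (ha : ¬ T.IsAncestor a v) (hb : ¬ T.IsAncestor b v)
      (i : ℕ) (hi : i ≤ T.depth v) (j : Fin 2) :
      CrossAdj G v T T' (twinInsertion T v i j) (twinInsertion T' v i j)
  | on_path_moved (a b : V) (hrot : IsRotation G T a b T')
      (ha : T.IsAncestor a v) (hb : T.IsAncestor b v) (hbv : b ≠ v)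
      (hS : ∃ y, T.IsAncestor (T.pathVertex v (T.depth b + 1)) y ∧ G.Adj a y)
      (i : ℕ) (hi : i ≤ T.depth v) (hil : i ≠ T.depth b) (j : Fin 2) :
      CrossAdj G v T T' (twinInsertion T v i j) (twinInsertion T' v i j)
  | on_path_kept_above (a b : V) (hrot : IsRotation G T a b T')
      (ha : T.IsAncestor a v) (hb : T.IsAncestor b v) (hbv : b ≠ v)
      (hS : ¬ ∃ y, T.IsAncestor (T.pathVertex v (T.depth b + 1)) y ∧ G.Adj a y)
      (i : ℕ) (hil : i < T.depth b) (j : Fin 2) :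
      CrossAdj G v T T' (twinInsertion T v i j) (twinInsertion T' v i j)
  | on_path_kept_below (a b : V) (hrot : IsRotation G T a b T')
      (ha : T.IsAncestor a v) (hb : T.IsAncestor b v) (hbv : b ≠ v)
      (hS : ¬ ∃ y, T.IsAncestor (T.pathVertex v (T.depth b + 1)) y ∧ G.Adj a y)
      (i : ℕ) (hli : T.depth b ≤ i) (hi : i < T.depth v) (j : Fin 2) :
      CrossAdj G v T T' (twinInsertion T v (i + 1) j) (twinInsertion T' v i j)
  | at_twin (a : V) (hrot : IsRotation G T a v T')
      (i : ℕ) (hi : i < T.depth v) (j : Fin 2) :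
      CrossAdj G v T T' (twinInsertion T v i j) (twinInsertion T' v i j)

/-- The set `ε_e` for an edge `e = {T, T'}` of the rotation graph of `G`. -/
def crossEdges (G : SimpleGraph V) (v : V) (e : Sym2 (SearchTree G)) :
    Set (Sym2 (SearchTree (addTrueTwin G v))) :=
  {f | ∃ T T' : SearchTree G, e = s(T, T') ∧
    ∃ R R' : SearchTree (addTrueTwin G v), f = s(R, R') ∧ CrossAdj G v T.1 T'.1 R.1 R'.1}

end TrueTwins

open RootedTreeOn

namespace RootedTreeOn

variable {V W : Type u} (T : RootedTreeOn V) {T' : RootedTreeOn V} {a b c r s v x y : V}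

theorem isAncestor_refl (v : V) : T.IsAncestor v v := ⟨0, rfl⟩

theorem isAncestor_parent (v : V) : T.IsAncestor (T.parent v) v := ⟨1, rfl⟩

variable {T}

theorem IsAncestor.trans (h : T.IsAncestor a b) (h' : T.IsAncestor b c) : T.IsAncestor a c := by
  obtain ⟨m, rfl⟩ := h
  obtain ⟨n, rfl⟩ := h'
  exact ⟨m + n, Function.iterate_add_apply _ _ _ _⟩

theorem parent_iterate_root (n : ℕ) : T.parent^[n] T.root = T.root :=
  Function.iterate_fixed T.parent_root n

theorem isAncestor_root_iff : T.IsAncestor a T.root ↔ a = T.root := by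
  constructor
  · rintro ⟨n, rfl⟩
    exact parent_iterate_root n
  · rintro rfl
    exact T.isAncestor_refl _

variable (T) in
theorem root_isAncestor (v : V) : T.IsAncestor T.root v := T.reaches_root v

theorem isAncestor_iff : T.IsAncestor a v ↔ a = v ∨ (v ≠ T.root ∧ T.IsAncestor a (T.parent v)) := by
  constructor
  · rintro ⟨n, rfl⟩
    cases n with
    | zero => exact Or.inl rfl
    | succ n =>
      by_cases h : v = T.root
      · left
        rw [h]
        exact parent_iterate_root _
      · exact Or.inr ⟨h, n, (Function.iterate_succ_apply _ _ _).symm⟩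
  · rintro (rfl | ⟨-, h⟩)
    · exact T.isAncestor_refl _
    · exact h.trans (T.isAncestor_parent v)

theorem isAncestor_parent_of_ne (h : T.IsAncestor a v) (hne : a ≠ v) :
    T.IsAncestor a (T.parent v) :=
  ((isAncestor_iff.1 h).resolve_left hne).2

theorem IsChild.isAncestor (h : T.IsChild s r) : T.IsAncestor r s := h.2 ▸ T.isAncestor_parent s

theorem IsChild.isAncestor_iff (h : T.IsChild s r) :
    T.IsAncestor x s ↔ x = s ∨ T.IsAncestor x r := by
  rw [RootedTreeOn.isAncestor_iff, h.2]
  simp [h.1]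

variable (T) in
theorem depth_root : T.depth T.root = 0 := by
  classical
  exact (Nat.find_eq_zero _).2 rfl

theorem depth_of_ne_root (h : v ≠ T.root) : T.depth v = T.depth (T.parent v) + 1 := by
  classical
  exact Nat.find_comp_succ (T.reaches_root v) (T.reaches_root (T.parent v)) h

theorem IsChild.depth (h : T.IsChild s r) : T.depth s = T.depth r + 1 := by
  rw [depth_of_ne_root h.1, h.2]

/-- Induction from the root to the leaves. -/
theorem parent_induction {P : V → Prop} (root : P T.root)
    (step : ∀ v, v ≠ T.root → P (T.parent v) → P v) (v : V) : P v := by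
  obtain ⟨n, hn⟩ := T.reaches_root v
  induction n generalizing v with
  | zero =>
    obtain rfl : v = T.root := hn
    exact root
  | succ n ih =>
    by_cases h : v = T.root
    · exact h ▸ root
    · exact step v h (ih _ (by rwa [← Function.iterate_succ_apply]))

theorem depth_parent_iterate (n : ℕ) (v : V) : T.depth (T.parent^[n] v) = T.depth v - n := by
  induction n generalizing v with
  | zero => rfl
  | succ n ih =>
    rw [Function.iterate_succ_apply, ih]
    by_cases h : v = T.root
    · rw [h, T.parent_root, T.depth_root]
      omega
    · rw [depth_of_ne_root h]
      omega

theorem depth_eq_zero_iff : T.depth v = 0 ↔ v = T.root := by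
  refine ⟨fun h => ?_, fun h => h ▸ T.depth_root⟩
  by_contra h'
  rw [depth_of_ne_root h'] at h
  omega

theorem parent_eq_self_iff : T.parent v = v ↔ v = T.root := by
  refine ⟨fun h => ?_, fun h => h ▸ T.parent_root⟩
  by_contra h'
  have := depth_of_ne_root h'
  rw [h] at this
  omega

variable (T) in
theorem pathVertex_isAncestor (v : V) (i : ℕ) : T.IsAncestor (T.pathVertex v i) v := ⟨_, rfl⟩

theorem depth_pathVertex {i : ℕ} (hi : i ≤ T.depth v) : T.depth (T.pathVertex v i) = i := by
  rw [pathVertex, depth_parent_iterate]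
  omega

theorem IsAncestor.pathVertex_depth (h : T.IsAncestor a v) : T.pathVertex v (T.depth a) = a := by
  obtain ⟨n, rfl⟩ := h
  rw [pathVertex, depth_parent_iterate]
  rcases le_total n (T.depth v) with hn | hn
  · rw [Nat.sub_sub_self hn]
  · obtain ⟨m, rfl⟩ := Nat.exists_eq_add_of_le' hn
    have h0 : T.parent^[T.depth v] v = T.root := by
      rw [← depth_eq_zero_iff, depth_parent_iterate, Nat.sub_self]
    rw [Function.iterate_add_apply, h0, parent_iterate_root, Nat.sub_eq_zero_of_le hn, Nat.sub_zero,
      h0]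

theorem IsAncestor.depth_le (h : T.IsAncestor a v) : T.depth a ≤ T.depth v := by
  obtain ⟨n, rfl⟩ := h
  rw [depth_parent_iterate]
  omega

theorem IsAncestor.eq_of_depth_le (h : T.IsAncestor a v) (hd : T.depth v ≤ T.depth a) : a = v := by
  have h1 := h.pathVertex_depth
  rw [← le_antisymm hd h.depth_le, (T.isAncestor_refl v).pathVertex_depth] at h1
  exact h1.symm

theorem IsAncestor.depth_lt (h : T.IsAncestor a v) (hne : a ≠ v) : T.depth a < T.depth v :=
  lt_of_not_ge fun h' => hne (h.eq_of_depth_le h')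

theorem IsAncestor.antisymm (h : T.IsAncestor a b) (h' : T.IsAncestor b a) : a = b :=
  h.eq_of_depth_le h'.depth_le

theorem IsAncestor.of_depth_le (ha : T.IsAncestor a v) (hb : T.IsAncestor b v)
    (h : T.depth a ≤ T.depth b) : T.IsAncestor a b := by
  rw [← ha.pathVertex_depth, ← hb.pathVertex_depth, pathVertex, pathVertex]
  refine ⟨T.depth b - T.depth a, ?_⟩
  rw [← Function.iterate_add_apply]
  congr 1
  have := hb.depth_le
  omega

theorem IsAncestor.total (ha : T.IsAncestor a v) (hb : T.IsAncestor b v) :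
    T.IsAncestor a b ∨ T.IsAncestor b a :=
  (le_total (T.depth a) (T.depth b)).imp (ha.of_depth_le hb) (hb.of_depth_le ha)

theorem IsChild.ne (h : T.IsChild s r) : s ≠ r := by
  rintro rfl
  exact h.1 (parent_eq_self_iff.1 h.2)

theorem IsChild.not_isAncestor (h : T.IsChild s r) : ¬ T.IsAncestor s r :=
  fun h' => h.ne (h'.antisymm h.isAncestor)

/-- The child of `r` towards a proper descendant of `r`. -/
theorem IsAncestor.exists_isChild (h : T.IsAncestor r x) (hne : r ≠ x) :
    ∃ s, T.IsChild s r ∧ T.IsAncestor s x := by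
  have hlt := h.depth_lt hne
  have hd : T.depth (T.pathVertex x (T.depth r + 1)) = T.depth r + 1 := depth_pathVertex hlt
  have hne0 : T.pathVertex x (T.depth r + 1) ≠ T.root := by
    intro h0
    rw [h0, T.depth_root] at hd
    omega
  have hA := T.pathVertex_isAncestor x (T.depth r + 1)
  refine ⟨_, ⟨hne0, ?_⟩, hA⟩
  have hp : T.IsAncestor (T.parent (T.pathVertex x (T.depth r + 1))) x :=
    (T.isAncestor_parent _).trans hA
  rw [depth_of_ne_root hne0] at hd
  refine (hp.of_depth_le h ?_).eq_of_depth_le ?_ <;> omega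

theorem IsChild.eq_of_isAncestor (hs : T.IsChild s r) (hc : T.IsChild c r) (h : T.IsAncestor s x)
    (h' : T.IsAncestor c x) : s = c := by
  have := hs.depth
  have := hc.depth
  refine (h.of_depth_le h' ?_).eq_of_depth_le ?_ <;> omega

theorem IsChild.eq_pathVertex (hs : T.IsChild s r) (h : T.IsAncestor s v) :
    T.pathVertex v (T.depth r + 1) = s := by
  rw [← hs.depth, h.pathVertex_depth]

theorem ncard_isAncestor [Finite V] (v : V) : {s | T.IsAncestor s v}.ncard = T.depth v + 1 := by
  induction v using T.parent_induction with
  | root =>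
    rw [T.depth_root]
    simp [isAncestor_root_iff]
  | step v hv ih =>
    have h : {s | T.IsAncestor s v} = insert v {s | T.IsAncestor s (T.parent v)} := by
      ext s
      simp [isAncestor_iff (v := v), hv]
    have hn : v ∉ {s | T.IsAncestor s (T.parent v)} := fun h' =>
      IsChild.not_isAncestor ⟨hv, rfl⟩ h'
    rw [h, Set.ncard_insert_of_notMem hn, ih, ← depth_of_ne_root hv]

section Map

theorem map_parent_iterate (f : V ≃ W) (n : ℕ) (x : V) :
    (T.map f).parent^[n] (f x) = f (T.parent^[n] x) := by
  induction n generalizing x with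
  | zero => rfl
  | succ n ih =>
    rw [Function.iterate_succ_apply, Function.iterate_succ_apply, ← ih]
    simp [map]

theorem map_isAncestor_iff (f : V ≃ W) {x y : W} :
    (T.map f).IsAncestor x y ↔ T.IsAncestor (f.symm x) (f.symm y) := by
  obtain ⟨x, rfl⟩ := f.surjective x
  obtain ⟨y, rfl⟩ := f.surjective y
  simp [IsAncestor, map_parent_iterate]

theorem map_isChild_iff (f : V ≃ W) {x y : W} :
    (T.map f).IsChild x y ↔ T.IsChild (f.symm x) (f.symm y) := by
  simp [IsChild, map, Equiv.eq_symm_apply, Equiv.symm_apply_eq]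

theorem map_depth (f : V ≃ W) (x : W) : (T.map f).depth x = T.depth (f.symm x) := by
  classical
  obtain ⟨x, rfl⟩ := f.surjective x
  unfold depth
  congr 1
  funext n
  rw [map_parent_iterate, Equiv.symm_apply_apply]
  simp [map]

theorem map_map_swap [DecidableEq V] (a b : V) :
    (T.map (Equiv.swap a b)).map (Equiv.swap a b) = T := by
  ext <;> simp [map]

end Map

section InsertAbove

theorem insertAbove_parent_some_of_ne (h : x ≠ c) :
    (T.insertAbove c).parent (some x) = some (T.parent x) := by simp [insertAbove, h]

variable (T) in
theorem insertAbove_parent_some_self (c : V) : (T.insertAbove c).parent (some c) = none := by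
  simp [insertAbove]

theorem insertAbove_parent_some_eq_none_iff : (T.insertAbove c).parent (some x) = none ↔ x = c := by
  simp [insertAbove]

theorem insertAbove_parent_none_of_ne (h : c ≠ T.root) :
    (T.insertAbove c).parent none = some (T.parent c) := by simp [insertAbove, h]

theorem insertAbove_root_of_ne (h : c ≠ T.root) : (T.insertAbove c).root = some T.root := by
  simp [insertAbove, h]

variable (T) in
theorem insertAbove_root_root : (T.insertAbove T.root).root = none := by simp [insertAbove]

theorem insertAbove_root_eq_none_iff : (T.insertAbove c).root = none ↔ c = T.root := by
  simp [insertAbove]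

theorem insertAbove_root_eq_some_iff :
    (T.insertAbove c).root = some x ↔ c ≠ T.root ∧ x = T.root := by
  by_cases h : c = T.root <;> simp [insertAbove, h, eq_comm]

theorem insertAbove_isChild_some_none : (T.insertAbove c).IsChild (some x) none ↔ x = c := by
  rw [IsChild, insertAbove_parent_some_eq_none_iff, and_iff_right_iff_imp]
  rintro rfl h
  obtain ⟨h, h'⟩ := insertAbove_root_eq_some_iff.1 h.symm
  exact h h'

theorem insertAbove_isChild_some_some :
    (T.insertAbove c).IsChild (some x) (some y) ↔ x ≠ c ∧ T.IsChild x y := by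
  by_cases h : x = c
  · subst h
    simp [IsChild, insertAbove_parent_some_self]
  · rw [IsChild, IsChild, insertAbove_parent_some_of_ne h, ne_eq, eq_comm (a := some x),
      insertAbove_root_eq_some_iff]
    by_cases hx : x = T.root
    · subst hx
      simp [Ne.symm h]
    · simp [h, hx]

theorem insertAbove_isChild_none_some :
    (T.insertAbove c).IsChild none (some y) ↔ T.IsChild c y := by
  by_cases h : c = T.root
  · simp [IsChild, insertAbove, h]
  · simp [IsChild, insertAbove, h]

theorem insertAbove_isAncestor_aux (z : Option V) (y : V) :
    (T.insertAbove c).IsAncestor z (some y) ↔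
      (∃ x, z = some x ∧ T.IsAncestor x y) ∨ z = none ∧ T.IsAncestor c y := by
  have hc : (T.insertAbove c).IsAncestor z (some c) ↔ z = some c ∨
      (T.insertAbove c).IsAncestor z none :=
    (insertAbove_isChild_some_none.2 rfl).isAncestor_iff
  induction y using T.parent_induction with
  | root =>
    by_cases h : c = T.root
    · subst h
      have := T.insertAbove_root_root
      rw [hc, ← this, isAncestor_root_iff]
      simp [isAncestor_root_iff]
    · rw [← insertAbove_root_of_ne h, isAncestor_root_iff, insertAbove_root_of_ne h]
      simp [isAncestor_root_iff, h]
  | step y hy ih =>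
    replace ih := Iff.intro ih.1 ih.2
    by_cases h : y = c
    · subst h
      rw [hc, (insertAbove_isChild_none_some.2 ⟨hy, rfl⟩).isAncestor_iff, ih]
      have h1 : ∀ x, T.IsAncestor x y ↔ _ := fun x => isAncestor_iff
      have h2 : ¬ T.IsAncestor y (T.parent y) := IsChild.not_isAncestor ⟨hy, rfl⟩
      cases z <;> simp [h1, hy, h2]
    · rw [(insertAbove_isChild_some_some.2 ⟨h, hy, rfl⟩).isAncestor_iff, ih]
      have h1 : ∀ x, T.IsAncestor x y ↔ _ := fun x => isAncestor_iff
      cases z <;> simp [h1, hy, Ne.symm h]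

theorem insertAbove_isAncestor_some_some :
    (T.insertAbove c).IsAncestor (some x) (some y) ↔ T.IsAncestor x y := by
  simp [insertAbove_isAncestor_aux]

theorem insertAbove_isAncestor_none_some :
    (T.insertAbove c).IsAncestor none (some y) ↔ T.IsAncestor c y := by
  simp [insertAbove_isAncestor_aux]

theorem insertAbove_isAncestor_some_none :
    (T.insertAbove c).IsAncestor (some x) none ↔ x ≠ c ∧ T.IsAncestor x c := by
  have h : (T.insertAbove c).IsAncestor (some x) (some c) ↔ _ :=
    (insertAbove_isChild_some_none.2 rfl).isAncestor_iff
  rw [insertAbove_isAncestor_some_some] at h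
  constructor
  · intro h'
    refine ⟨?_, h.2 (Or.inr h')⟩
    rintro rfl
    exact (insertAbove_isChild_some_none.2 rfl).not_isAncestor h'
  · rintro ⟨h1, h2⟩
    exact (h.1 h2).resolve_left (by simpa using h1)

variable (T) in
theorem insertAbove_depth_none (c : V) : (T.insertAbove c).depth none = T.depth c := by
  have key : ∀ y, ¬ T.IsAncestor c y → (T.insertAbove c).depth (some y) = T.depth y := by
    intro y
    induction y using T.parent_induction with
    | root =>
      intro h
      have h : c ≠ T.root := fun h' => h (isAncestor_root_iff.2 h')
      rw [T.depth_root, depth_eq_zero_iff, insertAbove_root_of_ne h]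
    | step y hy ih =>
      intro h
      have hne : y ≠ c := by
        rintro rfl
        exact h (T.isAncestor_refl _)
      rw [(insertAbove_isChild_some_some.2 ⟨hne, hy, rfl⟩).depth, depth_of_ne_root hy,
        ih fun h' => h (h'.trans (T.isAncestor_parent y))]
  by_cases h : c = T.root
  · subst h
    rw [depth_root, depth_eq_zero_iff, insertAbove_root_root]
  · have hc : T.IsChild c (T.parent c) := ⟨h, rfl⟩
    rw [(insertAbove_isChild_none_some.2 hc).depth, hc.depth, key _ hc.not_isAncestor]

theorem insertAbove_depth_some (h : T.IsAncestor c y) :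
    (T.insertAbove c).depth (some y) = T.depth y + 1 := by
  obtain ⟨n, hn⟩ := Nat.exists_eq_add_of_le h.depth_le
  induction n generalizing y with
  | zero =>
    obtain rfl := h.eq_of_depth_le hn.le
    rw [(insertAbove_isChild_some_none.2 rfl).depth, insertAbove_depth_none]
  | succ n ih =>
    have hne : y ≠ c := by
      rintro rfl
      omega
    have hy : y ≠ T.root := by
      rintro rfl
      exact hne (isAncestor_root_iff.1 h).symm
    have hd := depth_of_ne_root hy
    rw [(insertAbove_isChild_some_some.2 ⟨hne, hy, rfl⟩).depth, hd,
      ih (isAncestor_parent_of_ne h hne.symm) (by omega)]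

theorem insertAbove_injective {c' : V} (h : T.insertAbove c = T'.insertAbove c') :
    T = T' ∧ c = c' := by
  have hp : ∀ x, (T.insertAbove c).parent x = (T'.insertAbove c').parent x := fun x => by rw [h]
  have hr : (T.insertAbove c).root = (T'.insertAbove c').root := by rw [h]
  have hc : c = c' := by
    rw [← insertAbove_parent_some_eq_none_iff (T := T'), ← hp, insertAbove_parent_some_self]
  subst hc
  have hroot : T.root = T'.root := by
    by_cases h1 : c = T.root
    · have : (T'.insertAbove c).root = none := by rw [← hr, insertAbove_root_eq_none_iff, h1]
      rw [← h1, insertAbove_root_eq_none_iff.1 this]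
    · rw [insertAbove_root_of_ne h1] at hr
      exact (insertAbove_root_eq_some_iff.1 hr.symm).2
  refine ⟨?_, rfl⟩
  ext x
  · exact hroot
  · by_cases hx : x = c
    · subst hx
      by_cases h1 : x = T.root
      · rw [parent_eq_self_iff.2 h1, parent_eq_self_iff.2 (h1.trans hroot)]
      · have := hp none
        rw [insertAbove_parent_none_of_ne h1, insertAbove_parent_none_of_ne (hroot ▸ h1)] at this
        exact Option.some_injective _ this
    · have := hp (some x)
      rw [insertAbove_parent_some_of_ne hx, insertAbove_parent_some_of_ne hx] at this
      exact Option.some_injective _ this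

/-- A tree in which the new vertex has exactly one child arises by inserting the new vertex. -/
theorem exists_eq_insertAbove {R : RootedTreeOn (Option V)}
    (h : ∀ x, R.IsChild (some x) none ↔ x = c) : ∃ T : RootedTreeOn V, R = T.insertAbove c := by
  obtain ⟨hc0, hc⟩ := (h c).2 rfl
  have hx : ∀ x, R.parent (some x) = none → x = c := by
    intro x hx
    refine (h x).1 ⟨fun h0 => ?_, hx⟩
    rw [h0, R.parent_root, ← h0] at hx
    exact Option.some_ne_none _ hx
  let p : V → V := fun x => (R.parent (some x)).getD ((R.parent none).getD c)
  have hroot : p (R.root.getD c) = R.root.getD c := by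
    rcases hr : R.root with _ | r
    · have := R.parent_root
      rw [hr] at this
      simp [p, hc, this]
    · have := R.parent_root
      rw [hr] at this
      simp [p, this]
  have hreach : ∀ n x, R.depth (some x) = n → ∃ m : ℕ, p^[m] x = R.root.getD c := by
    intro n
    induction n using Nat.strong_induction_on with
    | _ n ih =>
      intro x hn
      by_cases hxr : some x = R.root
      · exact ⟨0, by simp [← hxr]⟩
      have hd := depth_of_ne_root hxr
      rcases hpx : R.parent (some x) with _ | y
      · by_cases h0 : none = R.root
        · refine ⟨0, ?_⟩
          rw [← h0]
          exact hx x hpx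
        · have hd0 := depth_of_ne_root h0
          rcases hp0 : R.parent none with _ | y
          · exact absurd (parent_eq_self_iff.1 hp0) h0
          · rw [hpx] at hd
            rw [hp0] at hd0
            obtain ⟨m, hm⟩ := ih _ (by omega) y rfl
            exact ⟨m + 1, by rw [Function.iterate_succ_apply]; simpa [p, hpx, hp0] using hm⟩
      · rw [hpx] at hd
        obtain ⟨m, hm⟩ := ih _ (by omega) y rfl
        exact ⟨m + 1, by rw [Function.iterate_succ_apply]; simpa [p, hpx] using hm⟩
  refine ⟨⟨R.root.getD c, p, hroot, fun x => hreach _ x rfl⟩, ?_⟩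
  have hcr : c = R.root.getD c ↔ R.root = none := by
    rcases hr : R.root with _ | r
    · simp
    · simp only [Option.getD_some, reduceCtorEq, iff_false]
      rintro rfl
      exact hc0 hr.symm
  ext1
  · by_cases hr : R.root = none
    · simp [insertAbove, hr]
    · rw [insertAbove_root_of_ne (by simpa [hcr] using hr)]
      obtain ⟨r, hr'⟩ := Option.ne_none_iff_exists'.1 hr
      simp [hr']
  · funext x
    rcases x with _ | x
    · by_cases hr : R.root = none
      · have := R.parent_root
        rw [hr] at this
        simp [insertAbove, hr, this]
      · rw [insertAbove_parent_none_of_ne (by simpa [hcr] using hr)]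
        rcases hp0 : R.parent none with _ | y
        · exact absurd (parent_eq_self_iff.1 hp0).symm hr
        · simp [p, hc, hp0]
    · by_cases hxc : x = c
      · rw [hxc, insertAbove_parent_some_self, hc]
      · rw [insertAbove_parent_some_of_ne hxc]
        rcases hpx : R.parent (some x) with _ | y
        · exact absurd (hx x hpx) hxc
        · simp [p, hpx]

end InsertAbove

end RootedTreeOn

section LocalCharacterization

variable {V : Type u} {G : SimpleGraph V} {T : RootedTreeOn V} {S C : Set V}
  {a b c r s v w x y z : V}

/-- A local description of search trees: the ends of every edge are comparable, and below every
vertex other than the root there is a neighbour of its parent. -/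
structure IsLocalSearchTree (G : SimpleGraph V) (T : RootedTreeOn V) : Prop where
  comparable : ∀ x y, G.Adj x y → T.IsAncestor x y ∨ T.IsAncestor y x
  exists_adj_parent : ∀ c, c ≠ T.root → ∃ y, T.IsAncestor c y ∧ G.Adj (T.parent c) y

/-- `x` and `y` are joined by a walk in `G` that stays in `S` after its start. -/
def ReachableIn (G : SimpleGraph V) (S : Set V) : V → V → Prop :=
  Relation.ReflTransGen fun x y => x ∈ S ∧ y ∈ S ∧ G.Adj x y

theorem ReachableIn.symm (h : ReachableIn G S x y) : ReachableIn G S y x :=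
  have : Std.Symm fun x y => x ∈ S ∧ y ∈ S ∧ G.Adj x y := ⟨fun _ _ h => ⟨h.2.1, h.1, h.2.2.symm⟩⟩
  Relation.ReflTransGen.stdSymm.symm _ _ h

theorem ReachableIn.mono {S' : Set V} (hS : S ⊆ S') (h : ReachableIn G S x y) :
    ReachableIn G S' x y :=
  Relation.ReflTransGen.mono (fun _ _ h => ⟨hS h.1, hS h.2.1, h.2.2⟩) _ _ h

theorem ReachableIn.mem (h : ReachableIn G S x y) (hx : x ∈ S) : y ∈ S := by
  induction h with
  | refl => exact hx
  | tail _ h _ => exact h.2.1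

theorem reachable_induce_iff {x y : S} :
    (G.induce S).Reachable x y ↔ ReachableIn G S x y := by
  rw [SimpleGraph.reachable_iff_reflTransGen]
  constructor
  · exact Relation.ReflTransGen.lift (p := fun x y => x ∈ S ∧ y ∈ S ∧ G.Adj x y) Subtype.val
      (fun a b h => ⟨a.2, b.2, h⟩) x y
  · intro h
    obtain ⟨y, hy⟩ := y
    simp only at h
    induction h with
    | refl => rfl
    | tail _ h ih => exact (ih h.1).tail h.2.2

theorem isComponentOf_iff :
    IsComponentOf G S C ↔ ∃ x ∈ S, C = {y | ReachableIn G S x y} := by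
  have key : ∀ x : S, Subtype.val '' ((G.induce S).connectedComponentMk x).supp =
      {y | ReachableIn G S x y} := by
    intro x
    ext y
    simp only [Set.mem_image, SimpleGraph.ConnectedComponent.mem_supp_iff,
      SimpleGraph.ConnectedComponent.eq, Set.mem_ofPred_eq]
    constructor
    · rintro ⟨y, hy, rfl⟩
      exact (reachable_induce_iff.1 hy).symm
    · intro h
      exact ⟨⟨y, h.mem x.2⟩, reachable_induce_iff.2 h.symm, rfl⟩
  constructor
  · rintro ⟨c, rfl⟩
    induction c using SimpleGraph.ConnectedComponent.ind with
    | h x => exact ⟨x, x.2, key x⟩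
  · rintro ⟨x, hx, rfl⟩
    exact ⟨(G.induce S).connectedComponentMk ⟨x, hx⟩, (key ⟨x, hx⟩).symm⟩

theorem IsComponentOf.subset (h : IsComponentOf G S C) : C ⊆ S := by
  obtain ⟨x, hx, rfl⟩ := isComponentOf_iff.1 h
  exact fun y hy => ReachableIn.mem hy hx

theorem IsComponentOf.mem_of_adj (h : IsComponentOf G S C) (hx : x ∈ C) (hy : y ∈ S)
    (hxy : G.Adj x y) : y ∈ C := by
  have hxS := h.subset hx
  obtain ⟨z, hz, rfl⟩ := isComponentOf_iff.1 h
  exact Relation.ReflTransGen.tail hx ⟨hxS, hy, hxy⟩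

theorem IsComponentOf.reachableIn (h : IsComponentOf G S C) (hx : x ∈ C) (hy : y ∈ C) :
    ReachableIn G C x y := by
  have hCS := h.subset
  have hadj : ∀ {x y}, x ∈ C → y ∈ S → G.Adj x y → y ∈ C := fun h1 h2 h3 => h.mem_of_adj h1 h2 h3
  obtain ⟨z, hz, hC⟩ := isComponentOf_iff.1 h
  have hxy : ReachableIn G S x y := by
    rw [hC] at hx hy
    exact (ReachableIn.symm hx).trans hy
  clear hy
  induction hxy with
  | refl => exact Relation.ReflTransGen.refl
  | tail _ h ih =>
    have hb := ih.mem hx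
    exact ih.tail ⟨hb, hadj hb h.2.1 h.2.2, h.2.2⟩

theorem exists_isComponentOf (hx : x ∈ S) : ∃ C, IsComponentOf G S C ∧ x ∈ C :=
  ⟨_, isComponentOf_iff.2 ⟨x, hx, rfl⟩, Relation.ReflTransGen.refl⟩

theorem IsComponentOf.exists_adj (hS : ∀ x ∈ S, ReachableIn G S x r)
    (h : IsComponentOf G (S \ {r}) C) : ∃ y ∈ C, G.Adj r y := by
  have hadj : ∀ {x y}, x ∈ C → y ∈ S \ {r} → G.Adj x y → y ∈ C :=
    fun h1 h2 h3 => h.mem_of_adj h1 h2 h3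
  have hsub := h.subset
  obtain ⟨x, hx, hC⟩ := isComponentOf_iff.1 h
  have hxC : x ∈ C := hC ▸ Relation.ReflTransGen.refl
  have hxr := hS x hx.1
  clear hC hx
  induction hxr using Relation.ReflTransGen.head_induction_on with
  | refl => exact absurd rfl (hsub hxC).2
  | @head x y hxy _ ih =>
    by_cases hy : y = r
    · subst hy
      exact ⟨x, hxC, hxy.2.2.symm⟩
    · exact ih (hadj hxC ⟨hxy.2.1, hy⟩ hxy.2.2)

theorem IsSearchTreeOn.mem (h : IsSearchTreeOn G T S r) : r ∈ S := by
  cases h with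
  | node _ _ c hr => exact hr

theorem IsSearchTreeOn.isAncestor (h : IsSearchTreeOn G T S r) : ∀ x ∈ S, T.IsAncestor r x := by
  induction h with
  | node S r c hr hchild hrec ih =>
    intro x hx
    by_cases hxr : x = r
    · exact hxr ▸ T.isAncestor_refl _
    · obtain ⟨C, hC, hxC⟩ := exists_isComponentOf (G := G) (S := S \ {r}) ⟨hx, hxr⟩
      exact (hchild C hC).isAncestor.trans (ih C hC x hxC)

theorem IsSearchTreeOn.comparable (h : IsSearchTreeOn G T S r) :
    ∀ x ∈ S, ∀ y ∈ S, G.Adj x y → T.IsAncestor x y ∨ T.IsAncestor y x := by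
  induction h with
  | node S r c hr hchild hrec ih =>
    intro x hx y hy hxy
    have hT := (IsSearchTreeOn.node S r c hr hchild hrec).isAncestor
    by_cases hxr : x = r
    · exact Or.inl (hxr ▸ hT y hy)
    by_cases hyr : y = r
    · exact Or.inr (hyr ▸ hT x hx)
    obtain ⟨C, hC, hxC⟩ := exists_isComponentOf (G := G) (S := S \ {r}) ⟨hx, hxr⟩
    exact ih C hC x hxC y (hC.mem_of_adj hxC ⟨hy, hyr⟩ hxy) hxy

theorem IsSearchTreeOn.exists_adj_parent (h : IsSearchTreeOn G T S r)
    (hS : ∀ x ∈ S, ∀ y ∈ S, ReachableIn G S x y) :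
    ∀ x ∈ S, x ≠ r → ∃ y, T.IsAncestor x y ∧ G.Adj (T.parent x) y := by
  induction h with
  | node S r c hr hchild hrec ih =>
    intro x hx hxr
    obtain ⟨C, hC, hxC⟩ := exists_isComponentOf (G := G) (S := S \ {r}) ⟨hx, hxr⟩
    by_cases hxc : x = c C
    · obtain ⟨y, hy, hadj⟩ := hC.exists_adj fun x hx => hS x hx r hr
      rw [hxc, (hchild C hC).2]
      exact ⟨y, (hrec C hC).isAncestor y hy, hadj⟩
    · exact ih C hC (fun x hx y hy => hC.reachableIn hx hy) x hxC hxc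

theorem SimpleGraph.Connected.reachableIn_univ (hG : G.Connected) (x y : V) :
    ReachableIn G Set.univ x y := by
  have := (SimpleGraph.reachable_iff_reflTransGen x y).1 (hG.preconnected x y)
  exact Relation.ReflTransGen.mono (fun _ _ h => ⟨trivial, trivial, h⟩) _ _ this

theorem IsSearchTree.isLocalSearchTree (hG : G.Connected) (h : IsSearchTree G T) :
    IsLocalSearchTree G T where
  comparable x y := IsSearchTreeOn.comparable h x trivial y trivial
  exists_adj_parent c hc := IsSearchTreeOn.exists_adj_parent h
    (fun x _ y _ => hG.reachableIn_univ x y) c trivial hc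

namespace IsLocalSearchTree

theorem exists_adj_of_isChild (h : IsLocalSearchTree G T) (hs : T.IsChild s r) :
    ∃ y, T.IsAncestor s y ∧ G.Adj r y := by
  rw [← hs.2]
  exact h.exists_adj_parent s hs.1

/-- Induction from the leaves to the root. -/
theorem _root_.RootedTreeOn.child_induction [Finite V] (T : RootedTreeOn V) {P : V → Prop}
    (step : ∀ r, (∀ s, T.IsChild s r → P s) → P r) (r : V) : P r := by
  obtain ⟨m, hm⟩ := (Set.finite_range T.depth).bddAbove
  have hm : ∀ x, T.depth x ≤ m := fun x => hm ⟨x, rfl⟩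
  obtain ⟨n, hn⟩ : ∃ n, m - T.depth r = n := ⟨_, rfl⟩
  induction n using Nat.strong_induction_on generalizing r with
  | _ n ih =>
    refine step r fun s hs => ih (m - T.depth s) ?_ s rfl
    have := hs.depth
    have := hm s
    omega

theorem reachableIn [Finite V] (h : IsLocalSearchTree G T) (r : V) :
    ∀ x, T.IsAncestor r x → ReachableIn G {x | T.IsAncestor r x} r x := by
  induction r using T.child_induction with
  | step r ih =>
    intro x hx
    by_cases hrx : r = x
    · exact hrx ▸ Relation.ReflTransGen.refl
    obtain ⟨s, hs, hsx⟩ := hx.exists_isChild hrx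
    obtain ⟨y, hy, hadj⟩ := h.exists_adj_of_isChild hs
    have hsub : {x | T.IsAncestor s x} ⊆ {x | T.IsAncestor r x} :=
      fun z hz => hs.isAncestor.trans hz
    have h1 : ReachableIn G {x | T.IsAncestor r x} r y :=
      Relation.ReflTransGen.single ⟨T.isAncestor_refl r, hsub hy, hadj⟩
    exact h1.trans (((ih s hs y hy).mono hsub).symm.trans ((ih s hs x hsx).mono hsub))

theorem exists_isChild_of_isComponentOf [Finite V] (h : IsLocalSearchTree G T) :
    IsComponentOf G ({x | T.IsAncestor r x} \ {r}) C →
      ∃ s, T.IsChild s r ∧ C = {x | T.IsAncestor s x} := by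
  rw [isComponentOf_iff]
  rintro ⟨x, ⟨hx, hxr⟩, rfl⟩
  obtain ⟨s, hs, hsx⟩ := IsAncestor.exists_isChild hx (Ne.symm hxr)
  refine ⟨s, hs, Set.Subset.antisymm ?_ ?_⟩
  · intro y hy
    simp only [Set.mem_ofPred_eq] at hy ⊢
    induction hy with
    | refl => exact hsx
    | tail _ hadj ih =>
      obtain ⟨-, ⟨hy, hyr⟩, hadj⟩ := hadj
      rcases h.comparable _ _ hadj with h1 | h1
      · exact ih.trans h1
      · rcases ih.total h1 with h2 | h2
        · exact h2
        · rcases hs.isAncestor_iff.1 h2 with rfl | h3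
          · exact T.isAncestor_refl _
          · exact absurd (h3.antisymm hy) hyr
  · intro y hy
    have hsub : {x | T.IsAncestor s x} ⊆ {x | T.IsAncestor r x} \ {r} := by
      intro z hz
      refine ⟨hs.isAncestor.trans hz, ?_⟩
      rintro rfl
      exact hs.not_isAncestor hz
    have hxy : ReachableIn G _ x y := (h.reachableIn s x hsx).symm.trans (h.reachableIn s y hy)
    exact hxy.mono hsub

open Classical in
theorem isSearchTreeOn [Finite V] (h : IsLocalSearchTree G T) (r : V) :
    IsSearchTreeOn G T {x | T.IsAncestor r x} r := by
  induction r using T.child_induction with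
  | step r ih =>
    let c : Set V → V := fun C =>
      if hC : ∃ s, T.IsChild s r ∧ C = {x | T.IsAncestor s x} then hC.choose else r
    have hc : ∀ C, IsComponentOf G ({x | T.IsAncestor r x} \ {r}) C →
        T.IsChild (c C) r ∧ C = {x | T.IsAncestor (c C) x} := by
      intro C hC
      have hC := h.exists_isChild_of_isComponentOf hC
      simp only [c, dif_pos hC]
      exact hC.choose_spec
    refine .node _ r c (T.isAncestor_refl r) (fun C hC => (hc C hC).1) fun C hC => ?_
    rw [(hc C hC).2]
    convert ih _ (hc C hC).1 using 2
    rw [← (hc C hC).2]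

theorem isSearchTree [Finite V] (h : IsLocalSearchTree G T) : IsSearchTree G T := by
  have : {x | T.IsAncestor T.root x} = Set.univ :=
    Set.eq_univ_of_forall fun x => T.root_isAncestor x
  rw [IsSearchTree, ← this]
  exact h.isSearchTreeOn T.root

/-- An automorphism maps search trees to search trees. -/
theorem map {W : Type u} {H : SimpleGraph W} (h : IsLocalSearchTree G T) (f : G ≃g H) :
    IsLocalSearchTree H (T.map f.toEquiv) where
  comparable x y hxy := by
    rw [map_isAncestor_iff, map_isAncestor_iff]
    exact h.comparable _ _ (f.symm.map_adj_iff.2 hxy)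
  exists_adj_parent c hc := by
    obtain ⟨c, rfl⟩ := f.surjective c
    obtain ⟨y, hy, hadj⟩ := h.exists_adj_parent c fun h' => hc (congrArg f h')
    refine ⟨f y, ?_, ?_⟩
    · rw [map_isAncestor_iff]
      change T.IsAncestor (f.symm (f c)) (f.symm (f y))
      simpa using hy
    · change H.Adj (f (T.parent (f.symm (f c)))) (f y)
      rw [f.symm_apply_apply]
      exact f.map_adj_iff.2 hadj

end IsLocalSearchTree

end LocalCharacterization

section Twin

variable {V : Type u} {G : SimpleGraph V} {v : V} {T : RootedTreeOn V} {c x y : V}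

theorem addTrueTwin_connected (hG : G.Connected) : (addTrueTwin G v).Connected := by
  have key : ∀ x, (addTrueTwin G v).Reachable (some v) x := by
    rintro (_ | x)
    · exact SimpleGraph.Adj.reachable (Or.inr rfl)
    · exact (hG.preconnected v x).map ⟨some, fun {a b} h => h⟩
  have : Nonempty (Option V) := ⟨none⟩
  exact ⟨fun x y => (key x).symm.trans (key y)⟩

open Classical in
/-- Exchanging `v` and its twin. -/
noncomputable def swapTwin (G : SimpleGraph V) (v : V) : addTrueTwin G v ≃g addTrueTwin G v where
  toEquiv := Equiv.swap (some v) none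
  map_rel_iff' := by
    have key : ∀ a, Equiv.swap (some v) none (some a) = if a = v then none else some a := by
      intro a
      by_cases h : a = v <;> simp [h, Equiv.swap_apply_def]
    rintro (_ | a) (_ | b)
    · simp
    · rw [key]
      by_cases hb : b = v <;> simp [hb, addTrueTwin]
    · rw [key]
      by_cases hb : a = v <;> simp [hb, addTrueTwin, G.adj_comm]
    · rw [key, key]
      by_cases ha : a = v <;> by_cases hb : b = v <;> simp [ha, hb, addTrueTwin, G.adj_comm]

theorem IsLocalSearchTree.insertAbove (h : IsLocalSearchTree G T) (hc : T.IsAncestor c v) :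
    IsLocalSearchTree (addTrueTwin G v) (T.insertAbove c) where
  comparable := by
    have key : ∀ x, G.Adj v x ∨ x = v → (T.insertAbove c).IsAncestor none (some x) ∨
        (T.insertAbove c).IsAncestor (some x) none := by
      intro x hx
      rw [insertAbove_isAncestor_none_some, insertAbove_isAncestor_some_none]
      rcases hx with hx | rfl
      · rcases h.comparable _ _ hx with h1 | h1
        · exact Or.inl (hc.trans h1)
        · by_cases hxc : x = c
          · exact Or.inl (hxc ▸ T.isAncestor_refl c)
          · exact (hc.total h1).imp_right fun h2 => ⟨hxc, h2⟩
      · exact Or.inl hc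
    rintro (_ | x) (_ | y) hxy
    · exact hxy.elim
    · exact key y hxy
    · exact (key x hxy).symm
    · rw [insertAbove_isAncestor_some_some, insertAbove_isAncestor_some_some]
      exact h.comparable x y hxy
  exists_adj_parent := by
    rintro (_ | x) hx
    · have hc0 : c ≠ T.root := fun h' => hx (insertAbove_root_eq_none_iff.2 h').symm
      obtain ⟨y, hy, hadj⟩ := h.exists_adj_parent c hc0
      rw [insertAbove_parent_none_of_ne hc0]
      exact ⟨some y, insertAbove_isAncestor_none_some.2 hy, hadj⟩
    · by_cases hxc : x = c
      · rw [hxc, insertAbove_parent_some_self]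
        exact ⟨some v, insertAbove_isAncestor_some_some.2 hc, Or.inr rfl⟩
      · have hx0 : x ≠ T.root := by
          rintro rfl
          exact hx (insertAbove_root_of_ne (Ne.symm hxc)).symm
        obtain ⟨y, hy, hadj⟩ := h.exists_adj_parent x hx0
        rw [insertAbove_parent_some_of_ne hxc]
        exact ⟨some y, insertAbove_isAncestor_some_some.2 hy, hadj⟩

theorem IsLocalSearchTree.of_insertAbove (hc : T.IsAncestor c v)
    (h : IsLocalSearchTree (addTrueTwin G v) (T.insertAbove c)) : IsLocalSearchTree G T where
  comparable x y hxy := by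
    have := h.comparable (some x) (some y) hxy
    rwa [insertAbove_isAncestor_some_some, insertAbove_isAncestor_some_some] at this
  exists_adj_parent x hx := by
    have hp : T.IsChild x (T.parent x) := ⟨hx, rfl⟩
    by_cases hxc : x = c
    · subst hxc
      obtain ⟨_ | y, hy, hadj⟩ := h.exists_adj_of_isChild (insertAbove_isChild_none_some.2 hp)
      · refine ⟨v, hc, (hadj.resolve_right ?_).symm⟩
        intro h'
        exact hp.not_isAncestor (h' ▸ hc)
      · exact ⟨y, insertAbove_isAncestor_none_some.1 hy, hadj⟩
    · obtain ⟨_ | y, hy, hadj⟩ :=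
        h.exists_adj_of_isChild (insertAbove_isChild_some_some.2 ⟨hxc, hp⟩)
      · have hxv := (insertAbove_isAncestor_some_none.1 hy).2.trans hc
        refine ⟨v, hxv, (hadj.resolve_right ?_).symm⟩
        intro h'
        exact hp.not_isAncestor (h' ▸ hxv)
      · exact ⟨y, insertAbove_isAncestor_some_some.1 hy, hadj⟩

/-- A search tree on `G_v` in which the twin lies above `v` arises by inserting the twin above an
ancestor of `v` in a search tree on `G`. -/
theorem IsLocalSearchTree.exists_eq_insertAbove {R : RootedTreeOn (Option V)}
    (h : IsLocalSearchTree (addTrueTwin G v) R) (hv : R.IsAncestor none (some v)) :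
    ∃ T c, R = T.insertAbove c ∧ T.IsAncestor c v ∧ IsLocalSearchTree G T := by
  obtain ⟨c, hc, hcv⟩ := hv.exists_isChild (by simp)
  have hchild : ∀ s, R.IsChild s none → R.IsAncestor s (some v) := by
    intro s hs
    obtain ⟨_ | y, hy, hadj⟩ := h.exists_adj_of_isChild hs
    · exact hadj.elim
    · rcases hadj with hadj | rfl
      · rcases h.comparable (some v) (some y) hadj with h1 | h1
        · rcases hy.total h1 with h2 | h2
          · exact h2
          · rcases hs.isAncestor_iff.1 h2 with h3 | h3
            · exact h3 ▸ R.isAncestor_refl _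
            · exact absurd (h3.antisymm hv) (by simp)
        · exact hy.trans h1
      · exact hy
  obtain _ | c := c
  · exact absurd rfl hc.ne
  obtain ⟨T, rfl⟩ := RootedTreeOn.exists_eq_insertAbove (R := R) (c := c) fun x =>
    ⟨fun hx => Option.some_injective _ (hx.eq_of_isAncestor hc (hchild _ hx) hcv),
      fun hx => hx ▸ hc⟩
  have hcv' := insertAbove_isAncestor_some_some.1 hcv
  exact ⟨T, c, rfl, hcv', h.of_insertAbove hcv'⟩

end Twin

section Rotation

variable {V W : Type u} {G : SimpleGraph V} {T T' : RootedTreeOn V} {a b c r s v w x y z : V}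

namespace IsRotation

theorem ne (h : IsRotation G T a b T') : a ≠ b := h.isChild.ne.symm

theorem tree_ne (h : IsRotation G T a b T') : T ≠ T' := by
  rintro rfl
  exact h.ne (h.lower.isAncestor.antisymm h.isChild.isAncestor).symm

open Classical in
theorem root_eq (h : IsRotation G T a b T') : T'.root = if a = T.root then b else T.root := by
  split_ifs with ha
  · exact h.raise_of_root ha
  · exact (h.raise_of_not_root ha).1

/-- The new parent of a vertex other than the two rotated ones. -/
theorem parent_cases (h : IsRotation G T a b T') (ha : s ≠ a) (hb : s ≠ b) :
    (T.IsChild s b ∧ (∃ y, T.IsAncestor s y ∧ G.Adj a y) ∧ T'.parent s = a) ∨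
      (¬ (T.IsChild s b ∧ ∃ y, T.IsAncestor s y ∧ G.Adj a y) ∧ T'.parent s = T.parent s) := by
  by_cases hs : T.IsChild s b ∧ ∃ y, T.IsAncestor s y ∧ G.Adj a y
  · exact Or.inl ⟨hs.1, hs.2, h.moved s hs.1 hs.2⟩
  · exact Or.inr ⟨hs, h.kept s ha hb hs⟩

theorem ne_root_iff (h : IsRotation G T a b T') (ha : s ≠ a) (hb : s ≠ b) :
    s ≠ T'.root ↔ s ≠ T.root := by
  rw [h.root_eq]
  split_ifs with h'
  · simp [← h', ha, hb]
  · rfl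

theorem unique {T'' : RootedTreeOn V} (h : IsRotation G T a b T') (h' : IsRotation G T a b T'') :
    T' = T'' := by
  have hroot : T'.root = T''.root := by rw [h.root_eq, h'.root_eq]
  ext s
  · exact hroot
  · by_cases ha : s = a
    · rw [ha, h.lower.2, h'.lower.2]
    by_cases hb : s = b
    · subst hb
      by_cases har : a = T.root
      · rw [parent_eq_self_iff.2 (h.raise_of_root har).symm,
          parent_eq_self_iff.2 (h'.raise_of_root har).symm]
      · rw [(h.raise_of_not_root har).2, (h'.raise_of_not_root har).2]
    · rcases h.parent_cases ha hb with h1 | h1 <;> rcases h'.parent_cases ha hb with h2 | h2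
      · rw [h1.2.2, h2.2.2]
      · exact absurd ⟨h1.1, h1.2.1⟩ h2.1
      · exact absurd ⟨h2.1, h2.2.1⟩ h1.1
      · rw [h1.2, h2.2]

theorem isChild_of_ne_root (h : IsRotation G T a b T') (ha : a ≠ T.root) :
    T'.IsChild b (T.parent a) := by
  obtain ⟨h1, h2⟩ := h.raise_of_not_root ha
  exact ⟨h1 ▸ h.isChild.1, h2⟩

/-- Ancestors in the rotated tree, other than the two rotated vertices. -/
theorem isAncestor_iff (h : IsRotation G T a b T') (ha : s ≠ a) (hb : s ≠ b) :
    T'.IsAncestor s y ↔ T.IsAncestor s y := by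
  constructor
  · induction y using T'.parent_induction with
    | root =>
      intro h'
      have h1 := isAncestor_root_iff.1 h'
      have h2 : ¬ s ≠ T'.root := fun h2 => h2 h1
      rw [h.ne_root_iff ha hb, not_not] at h2
      exact h2 ▸ T.root_isAncestor _
    | step y hy ih =>
      intro h'
      rcases RootedTreeOn.isAncestor_iff.1 h' with rfl | ⟨-, h'⟩
      · exact T.isAncestor_refl _
      have h' := ih h'
      by_cases hya : y = a
      · subst hya
        rw [h.lower.2] at h'
        exact (h.isChild.isAncestor_iff.1 h').resolve_left hb
      by_cases hyb : y = b
      · subst hyb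
        have har : a ≠ T.root := fun har => hy (h.raise_of_root har).symm
        rw [(h.raise_of_not_root har).2] at h'
        exact (h'.trans (T.isAncestor_parent _)).trans h.isChild.isAncestor
      · rcases h.parent_cases hya hyb with ⟨h1, -, h2⟩ | ⟨-, h2⟩
        · rw [h2] at h'
          exact (h'.trans h.isChild.isAncestor).trans h1.isAncestor
        · rw [h2] at h'
          exact h'.trans (T.isAncestor_parent _)
  · induction y using T.parent_induction with
    | root =>
      intro h'
      have h1 := isAncestor_root_iff.1 h'
      have h2 : ¬ s ≠ T.root := fun h2 => h2 h1
      rw [← h.ne_root_iff ha hb, not_not] at h2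
      exact h2 ▸ T'.root_isAncestor _
    | step y hy ih =>
      intro h'
      rcases RootedTreeOn.isAncestor_iff.1 h' with rfl | ⟨-, h'⟩
      · exact T'.isAncestor_refl _
      have h' := ih h'
      by_cases hya : y = a
      · subst hya
        exact (h'.trans (h.isChild_of_ne_root hy).isAncestor).trans h.lower.isAncestor
      by_cases hyb : y = b
      · subst hyb
        rw [h.isChild.2] at h'
        exact (h.lower.isAncestor_iff.1 h').resolve_left ha
      · rcases h.parent_cases hya hyb with ⟨h1, -, h2⟩ | ⟨-, h2⟩
        · rw [h1.2] at h'
          have : T'.IsAncestor a y := h2 ▸ T'.isAncestor_parent y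
          exact (h'.trans h.lower.isAncestor).trans this
        · rw [← h2] at h'
          exact h'.trans (T'.isAncestor_parent _)

theorem isAncestor_raised_iff (h : IsRotation G T a b T') :
    T'.IsAncestor b y ↔ T.IsAncestor a y := by
  constructor
  · induction y using T'.parent_induction with
    | root =>
      intro h'
      have h1 := isAncestor_root_iff.1 h'
      have har : a = T.root := by
        by_contra har
        exact h.isChild.1 (h1.trans (h.raise_of_not_root har).1)
      exact har ▸ T.root_isAncestor _
    | step y hy ih =>
      intro h'
      rcases RootedTreeOn.isAncestor_iff.1 h' with rfl | ⟨-, h'⟩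
      · exact h.isChild.isAncestor
      have h' := ih h'
      by_cases hya : y = a
      · exact hya ▸ T.isAncestor_refl _
      by_cases hyb : y = b
      · exact hyb ▸ h.isChild.isAncestor
      · rcases h.parent_cases hya hyb with ⟨h1, -, h2⟩ | ⟨-, h2⟩
        · exact h.isChild.isAncestor.trans h1.isAncestor
        · rw [h2] at h'
          exact h'.trans (T.isAncestor_parent _)
  · induction y using T.parent_induction with
    | root =>
      intro h'
      rw [← h.raise_of_root (isAncestor_root_iff.1 h')]
      exact T'.root_isAncestor _
    | step y hy ih =>
      intro h'
      rcases RootedTreeOn.isAncestor_iff.1 h' with rfl | ⟨-, h'⟩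
      · exact h.lower.isAncestor
      have h' := ih h'
      by_cases hya : y = a
      · exact hya ▸ h.lower.isAncestor
      by_cases hyb : y = b
      · exact hyb ▸ T'.isAncestor_refl _
      · rcases h.parent_cases hya hyb with ⟨h1, -, h2⟩ | ⟨-, h2⟩
        · have : T'.IsAncestor a y := h2 ▸ T'.isAncestor_parent y
          exact h.lower.isAncestor.trans this
        · rw [← h2] at h'
          exact h'.trans (T'.isAncestor_parent _)

/-- Rotations of search trees are reversible. -/
theorem symm (h : IsRotation G T a b T') (hT : IsLocalSearchTree G T) :
    IsRotation G T' b a T where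
  isChild := h.lower
  lower := h.isChild
  raise_of_root hb := by
    by_contra ha
    exact h.isChild.1 (hb.trans (h.raise_of_not_root (Ne.symm ha)).1)
  raise_of_not_root hb := by
    have ha : a ≠ T.root := fun ha => hb (h.raise_of_root ha).symm
    obtain ⟨h1, h2⟩ := h.raise_of_not_root ha
    exact ⟨h1.symm, h2.symm⟩
  moved s hs hy := by
    obtain ⟨y, hy, hadj⟩ := hy
    have hsb : s ≠ b := by
      rintro rfl
      exact hs.not_isAncestor h.lower.isAncestor
    rcases h.parent_cases hs.ne hsb with ⟨h1, -, -⟩ | ⟨-, h2⟩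
    · exact h1.2
    · have hs' : T.IsChild s a := ⟨(h.ne_root_iff hs.ne hsb).1 hs.1, h2 ▸ hs.2⟩
      rw [h.isAncestor_iff hs.ne hsb] at hy
      have hsb' : T.IsAncestor s b ∨ T.IsAncestor b s := by
        rcases hT.comparable _ _ hadj with h3 | h3
        · exact (hy.total h3)
        · exact Or.inl (hy.trans h3)
      rcases hsb' with h3 | h3
      · exact absurd (hs'.eq_of_isAncestor h.isChild h3 (T.isAncestor_refl b)) hsb
      · exact absurd (hs'.eq_of_isAncestor h.isChild (T.isAncestor_refl s) h3) hsb
  kept s hsb hsa hs := by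
    rcases h.parent_cases hsa hsb with ⟨h1, -, h2⟩ | ⟨-, h2⟩
    · refine absurd ⟨⟨(h.ne_root_iff hsa hsb).2 h1.1, h2⟩, ?_⟩ hs
      obtain ⟨y, hy, hadj⟩ := hT.exists_adj_of_isChild h1
      exact ⟨y, (h.isAncestor_iff hsa hsb).2 hy, hadj⟩
    · exact h2.symm

open Classical in
theorem depth_add [Finite V] (h : IsRotation G T a b T') (x : V) :
    T'.depth x + (if T.IsAncestor b x then 1 else 0) =
      T.depth x + if T'.IsAncestor a x then 1 else 0 := by
  have key : ∀ U : RootedTreeOn V, U.depth x + 1 =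
      ({s | U.IsAncestor s x} \ {a, b}).ncard + (if U.IsAncestor a x then 1 else 0) +
        if U.IsAncestor b x then 1 else 0 := by
    intro U
    rw [← ncard_isAncestor, ← Set.ncard_inter_add_ncard_sdiff_eq_ncard {s | U.IsAncestor s x} {a, b},
      add_comm, add_assoc]
    congr 1
    by_cases ha : U.IsAncestor a x <;> by_cases hb : U.IsAncestor b x
    · rw [Set.inter_eq_right.2 (by rintro s (rfl | rfl) <;> assumption), Set.ncard_pair h.ne]
      simp [ha, hb]
    · have : {s | U.IsAncestor s x} ∩ {a, b} = {a} := by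
        ext s
        simp only [Set.mem_inter_iff, Set.mem_ofPred_eq, Set.mem_insert_iff, Set.mem_singleton_iff]
        constructor
        · rintro ⟨h1, rfl | rfl⟩
          · rfl
          · exact absurd h1 hb
        · rintro rfl
          exact ⟨ha, Or.inl rfl⟩
      simp [this, ha, hb]
    · have : {s | U.IsAncestor s x} ∩ {a, b} = {b} := by
        ext s
        simp only [Set.mem_inter_iff, Set.mem_ofPred_eq, Set.mem_insert_iff, Set.mem_singleton_iff]
        constructor
        · rintro ⟨h1, rfl | rfl⟩
          · exact absurd h1 ha
          · rfl
        · rintro rfl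
          exact ⟨hb, Or.inr rfl⟩
      simp [this, ha, hb]
    · have : {s | U.IsAncestor s x} ∩ {a, b} = ∅ := by
        ext s
        simp only [Set.mem_inter_iff, Set.mem_ofPred_eq, Set.mem_insert_iff, Set.mem_singleton_iff,
          Set.mem_empty_iff_false, iff_false]
        rintro ⟨h1, rfl | rfl⟩
        · exact ha h1
        · exact hb h1
      simp [this, ha, hb]
  have h1 := key T
  have h2 := key T'
  have h3 : {s | T'.IsAncestor s x} \ {a, b} = {s | T.IsAncestor s x} \ {a, b} := by
    ext s
    simp only [Set.mem_sdiff, Set.mem_ofPred_eq, Set.mem_insert_iff, Set.mem_singleton_iff, not_or]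
    exact and_congr_left fun h' => h.isAncestor_iff h'.1 h'.2
  rw [h3] at h2
  simp only [h.isAncestor_raised_iff] at h2
  omega

theorem depth_le [Finite V] (h : IsRotation G T a b T') (x : V) :
    T'.depth x ≤ T.depth x + 1 ∧ T.depth x ≤ T'.depth x + 1 := by
  classical
  have := h.depth_add x
  split_ifs at this <;> omega

theorem map {H : SimpleGraph W} (h : IsRotation G T a b T') (f : G ≃g H) :
    IsRotation H (T.map f.toEquiv) (f a) (f b) (T'.map f.toEquiv) := by
  have hsymm : ∀ x, f.toEquiv.symm (f x) = x := f.symm_apply_apply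
  have hp : ∀ (U : RootedTreeOn V) x, (U.map f.toEquiv).parent (f x) = f (U.parent x) := by
    intro U x
    change f (U.parent (f.symm (f x))) = _
    rw [f.symm_apply_apply]
  have hr : ∀ U : RootedTreeOn V, (U.map f.toEquiv).root = f U.root := fun _ => rfl
  have hc : ∀ (U : RootedTreeOn V) x y, (U.map f.toEquiv).IsChild (f x) (f y) ↔ U.IsChild x y := by
    intro U x y
    rw [map_isChild_iff, hsymm, hsymm]
  have hmem : ∀ s, ((T.map f.toEquiv).IsChild (f s) (f b) ∧
      ∃ y, (T.map f.toEquiv).IsAncestor (f s) y ∧ H.Adj (f a) y) ↔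
        (T.IsChild s b ∧ ∃ y, T.IsAncestor s y ∧ G.Adj a y) := by
    intro s
    rw [hc, f.surjective.exists]
    simp only [map_isAncestor_iff, hsymm, f.map_adj_iff]
  constructor
  · exact (hc _ _ _).2 h.isChild
  · exact (hc _ _ _).2 h.lower
  · intro ha
    rw [hr, h.raise_of_root (f.injective ha)]
  · intro ha
    obtain ⟨h1, h2⟩ := h.raise_of_not_root fun h' => ha (congrArg f h')
    rw [hr, hp, hp, h1, h2, hr]
    exact ⟨rfl, rfl⟩
  · intro s h1 h2
    obtain ⟨s, rfl⟩ := f.surjective s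
    obtain ⟨h1, h2⟩ := (hmem s).1 ⟨h1, h2⟩
    rw [hp, h.moved s h1 h2]
  · intro s h1 h2 h3
    obtain ⟨s, rfl⟩ := f.surjective s
    rw [hmem] at h3
    rw [hp, hp, h.kept s (fun h' => h1 (congrArg f h')) (fun h' => h2 (congrArg f h')) h3]

end IsRotation

theorem rotationGraph_adj_iff [Finite V] (hG : G.Connected) {U U' : SearchTree G} :
    (rotationGraph G).Adj U U' ↔ ∃ a b, IsRotation G U.1 a b U'.1 := by
  rw [rotationGraph, SimpleGraph.fromRel_adj]
  constructor
  · rintro ⟨-, h | ⟨a, b, h⟩⟩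
    · exact h
    · exact ⟨b, a, h.symm (U'.2.isLocalSearchTree hG)⟩
  · rintro ⟨a, b, h⟩
    exact ⟨fun h' => h.tree_ne (congrArg Subtype.val h'), Or.inl ⟨a, b, h⟩⟩

end Rotation

section TwinRotation

variable {V : Type u} {G : SimpleGraph V} {T T' : RootedTreeOn V} {a b c c' d s v x y : V}

/-- The subtree of a child of `b` meets the neighbourhood of the parent of `b` in the same way
before and after inserting the twin. -/
theorem insertAbove_exists_adj_iff (hc : T.IsAncestor c v) (ha : ¬ T.IsAncestor s a) :
    (∃ y, (T.insertAbove c).IsAncestor (some s) y ∧ (addTrueTwin G v).Adj (some a) y) ↔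
      ∃ y, T.IsAncestor s y ∧ G.Adj a y := by
  constructor
  · rintro ⟨_ | y, hy, hadj⟩
    · have hsv := (insertAbove_isAncestor_some_none.1 hy).2.trans hc
      rcases hadj with hadj | rfl
      · exact ⟨v, hsv, hadj.symm⟩
      · exact absurd hsv ha
    · exact ⟨y, insertAbove_isAncestor_some_some.1 hy, hadj⟩
  · rintro ⟨y, hy, hadj⟩
    exact ⟨some y, insertAbove_isAncestor_some_some.2 hy, hadj⟩

theorem insertAbove_none_exists_adj_iff (hc : T.IsAncestor c v) (ha : ¬ T.IsAncestor c a) :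
    (∃ y, (T.insertAbove c).IsAncestor none y ∧ (addTrueTwin G v).Adj (some a) y) ↔
      ∃ y, T.IsAncestor c y ∧ G.Adj a y := by
  constructor
  · rintro ⟨_ | y, hy, hadj⟩
    · rcases hadj with hadj | rfl
      · exact ⟨v, hc, hadj.symm⟩
      · exact absurd hc ha
    · exact ⟨y, insertAbove_isAncestor_none_some.1 hy, hadj⟩
  · rintro ⟨y, hy, hadj⟩
    exact ⟨some y, insertAbove_isAncestor_none_some.2 hy, hadj⟩

theorem RootedTreeOn.IsChild.not_isAncestor_of_isChild (hs : T.IsChild s b) (hb : T.IsChild b a) :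
    ¬ T.IsAncestor s a :=
  fun h => hs.not_isAncestor (h.trans hb.isAncestor)

open Classical in
theorem IsRotation.insertAbove (h : IsRotation G T a b T') (hc : T.IsAncestor c v) (hcb : c ≠ b) :
    IsRotation (addTrueTwin G v) (T.insertAbove c) (some a) (some b)
      (T'.insertAbove (if c = a then b else c)) := by
  have hab := h.ne
  have hroot := h.root_eq
  have hb0 := h.isChild.1
  have hca : a = (if c = a then b else c) ↔ False := by
    rw [iff_false]
    split_ifs with h'
    · exact hab
    · exact Ne.symm h'
  have hcr : (if c = a then b else c) = T'.root ↔ c = T.root := by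
    rw [hroot]
    split_ifs with h1 h2 h2
    · simp [h1, h2]
    · simp [h1, h2, hb0]
    · simp [hcb, ← h2, h1]
    · rfl
  have hmem : ∀ s, ((T.insertAbove c).IsChild (some s) (some b) ∧
      ∃ y, (T.insertAbove c).IsAncestor (some s) y ∧ (addTrueTwin G v).Adj (some a) y) ↔
      s ≠ c ∧ T.IsChild s b ∧ ∃ y, T.IsAncestor s y ∧ G.Adj a y := by
    intro s
    rw [insertAbove_isChild_some_some, and_assoc]
    refine and_congr_right fun _ => and_congr_right fun hs => ?_
    exact insertAbove_exists_adj_iff hc (hs.not_isAncestor_of_isChild h.isChild)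
  have hmem0 : ((T.insertAbove c).IsChild none (some b) ∧
      ∃ y, (T.insertAbove c).IsAncestor none y ∧ (addTrueTwin G v).Adj (some a) y) ↔
      T.IsChild c b ∧ ∃ y, T.IsAncestor c y ∧ G.Adj a y := by
    rw [insertAbove_isChild_none_some]
    refine and_congr_right fun hs => ?_
    exact insertAbove_none_exists_adj_iff hc (hs.not_isAncestor_of_isChild h.isChild)
  have hpb : b ≠ c → (T.insertAbove c).parent (some b) = some a := fun h' => by
    rw [insertAbove_parent_some_of_ne h', h.isChild.2]
  constructor
  · exact insertAbove_isChild_some_some.2 ⟨hcb.symm, h.isChild⟩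
  · refine insertAbove_isChild_some_some.2 ⟨fun h' => hca.1 h', h.lower⟩
  · intro ha
    obtain ⟨h1, h2⟩ := insertAbove_root_eq_some_iff.1 ha.symm
    rw [insertAbove_root_of_ne (by rwa [ne_eq, hcr]), h.raise_of_root h2]
  · intro ha
    by_cases hc0 : c = T.root
    · rw [insertAbove_root_eq_none_iff.2 (hcr.2 hc0), insertAbove_root_eq_none_iff.2 hc0]
      refine ⟨rfl, ?_⟩
      by_cases hc : c = a
      · rw [if_pos hc, hc, insertAbove_parent_some_self, insertAbove_parent_some_self]
      · have ha0 : a ≠ T.root := fun h' => hc (hc0.trans h'.symm)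
        rw [if_neg hc, insertAbove_parent_some_of_ne (Ne.symm hcb),
          insertAbove_parent_some_of_ne (Ne.symm hc), (h.raise_of_not_root ha0).2]
    · have hc0' : (if c = a then b else c) ≠ T'.root := by rwa [ne_eq, hcr]
      have ha0 : a ≠ T.root := fun h' => ha (by rw [insertAbove_root_of_ne hc0, h'])
      obtain ⟨h1, h2⟩ := h.raise_of_not_root ha0
      rw [insertAbove_root_of_ne hc0, insertAbove_root_of_ne hc0', h1]
      refine ⟨rfl, ?_⟩
      by_cases hc : c = a
      · rw [if_pos hc, hc, insertAbove_parent_some_self, insertAbove_parent_some_self]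
      · rw [if_neg hc, insertAbove_parent_some_of_ne (Ne.symm hcb),
          insertAbove_parent_some_of_ne (Ne.symm hc), h2]
  · rintro (_ | s) hs hy
    · obtain ⟨h1, h2⟩ := hmem0.1 ⟨hs, hy⟩
      have hca' : c ≠ a := by
        rintro rfl
        exact h1.not_isAncestor h.isChild.isAncestor
      have hc0' : (if c = a then b else c) ≠ T'.root := by
        rw [ne_eq, hcr]
        exact h1.1
      rw [insertAbove_parent_none_of_ne hc0', if_neg hca', h.moved c h1 h2]
    · obtain ⟨h0, h1, h2⟩ := (hmem s).1 ⟨hs, hy⟩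
      have : s ≠ if c = a then b else c := by
        split_ifs
        · exact h1.ne
        · exact h0
      rw [insertAbove_parent_some_of_ne this, h.moved s h1 h2]
  · rintro (_ | s) hsa hsb hs
    · rw [hmem0] at hs
      by_cases hc0 : c = T.root
      · have h1 := insertAbove_root_eq_none_iff.2 (hcr.2 hc0)
        have h2 := insertAbove_root_eq_none_iff.2 hc0
        rw [parent_eq_self_iff.2 h1.symm, parent_eq_self_iff.2 h2.symm]
      · have hc0' : (if c = a then b else c) ≠ T'.root := by rwa [ne_eq, hcr]
        rw [insertAbove_parent_none_of_ne hc0, insertAbove_parent_none_of_ne hc0']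
        by_cases hc : c = a
        · rw [if_pos hc, (h.raise_of_not_root (hc ▸ hc0)).2, hc]
        · rw [if_neg hc, h.kept c hc hcb hs]
    · rw [hmem] at hs
      have hsa : s ≠ a := fun h' => hsa (congrArg some h')
      have hsb : s ≠ b := fun h' => hsb (congrArg some h')
      by_cases hsc : s = c
      · rw [← hsc, if_neg hsa, insertAbove_parent_some_self, insertAbove_parent_some_self]
      · have : s ≠ if c = a then b else c := by
          split_ifs
          · exact hsb
          · exact hsc
        rw [insertAbove_parent_some_of_ne this, insertAbove_parent_some_of_ne hsc,
          h.kept s hsa hsb fun h' => hs ⟨hsc, h'⟩]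

/-- The rotation of the twin and its child `c ≠ v` moves the twin down on the path to `v`. -/
theorem isRotation_insertAbove_of_isChild (hT : IsLocalSearchTree G T) (hd : T.IsChild d c)
    (hdv : T.IsAncestor d v) :
    IsRotation (addTrueTwin G v) (T.insertAbove c) none (some c) (T.insertAbove d) := by
  have key : ∀ s, T.IsChild s c →
      (∃ y, (T.insertAbove c).IsAncestor (some s) y ∧ (addTrueTwin G v).Adj none y) → s = d := by
    rintro s hs ⟨_ | y, hy, hadj⟩
    · exact hadj.elim
    · rw [insertAbove_isAncestor_some_some] at hy
      rcases hadj with hadj | rfl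
      · rcases hT.comparable _ _ hadj with h1 | h1
        · exact hs.eq_of_isAncestor hd hy (hdv.trans h1)
        · exact hs.eq_of_isAncestor hd (hy.trans h1) hdv
      · exact hs.eq_of_isAncestor hd hy hdv
  constructor
  · exact insertAbove_isChild_some_none.2 rfl
  · exact insertAbove_isChild_none_some.2 hd
  · intro h
    rw [insertAbove_root_of_ne hd.1, insertAbove_root_eq_none_iff.1 h.symm]
  · intro h
    have hc : c ≠ T.root := fun h' => h (insertAbove_root_eq_none_iff.2 h').symm
    rw [insertAbove_root_of_ne hc, insertAbove_root_of_ne hd.1, insertAbove_parent_none_of_ne hc,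
      insertAbove_parent_some_of_ne hd.ne.symm]
    exact ⟨rfl, rfl⟩
  · rintro (_ | s) hs hy
    · exact absurd rfl (insertAbove_isChild_none_some.1 hs).ne
    · rw [key s (insertAbove_isChild_some_some.1 hs).2 hy, insertAbove_parent_some_self]
  · rintro (_ | s) h1 h2 hs
    · exact absurd rfl h1
    · have hsc : s ≠ c := fun h' => h2 (congrArg some h')
      have hsd : s ≠ d := by
        rintro rfl
        exact hs ⟨insertAbove_isChild_some_some.2 ⟨hsc, hd⟩, some v,
          insertAbove_isAncestor_some_some.2 hdv, Or.inr rfl⟩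
      rw [insertAbove_parent_some_of_ne hsc, insertAbove_parent_some_of_ne hsd]

theorem swapTwin_apply_some_of_ne (h : x ≠ v) : swapTwin G v (some x) = some x := by
  classical
  exact Equiv.swap_apply_of_ne_of_ne (by simpa using h) (by simp)

theorem swapTwin_apply_some_self : swapTwin G v (some v) = none := by
  classical
  exact Equiv.swap_apply_left (some v) none

theorem swapTwin_apply_none : swapTwin G v none = some v := by
  classical
  exact Equiv.swap_apply_right (some v) none

theorem swapTwin_symm_apply (x : Option V) :
    (swapTwin G v).toEquiv.symm x = swapTwin G v x := rfl

theorem map_swapTwin_parent {R : RootedTreeOn (Option V)} (x : Option V) :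
    (R.map (swapTwin G v).toEquiv).parent x = swapTwin G v (R.parent (swapTwin G v x)) := rfl

theorem map_swapTwin_root {R : RootedTreeOn (Option V)} :
    (R.map (swapTwin G v).toEquiv).root = swapTwin G v R.root := rfl

theorem map_swapTwin_map_swapTwin (R : RootedTreeOn (Option V)) :
    (R.map (swapTwin G v).toEquiv).map (swapTwin G v).toEquiv = R := by
  classical
  exact map_map_swap (T := R) (some v) none

/-- The rotation of the twin and its child `v` exchanges the two twins. -/
theorem isRotation_insertAbove_self (hT : IsLocalSearchTree G T) :
    IsRotation (addTrueTwin G v) (T.insertAbove v) none (some v)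
      ((T.insertAbove v).map (swapTwin G v).toEquiv) := by
  have hch : (T.insertAbove v).IsChild (some v) none := insertAbove_isChild_some_none.2 rfl
  have hpn : ∀ x, (T.insertAbove v).parent (some x) = none ↔ x = v :=
    fun x => insertAbove_parent_some_eq_none_iff
  constructor
  · exact hch
  · rw [map_isChild_iff, swapTwin_symm_apply, swapTwin_symm_apply, swapTwin_apply_none,
      swapTwin_apply_some_self]
    exact hch
  · intro h
    rw [map_swapTwin_root, ← h, swapTwin_apply_none]
  · intro h
    have hv : v ≠ T.root := fun h' => h (insertAbove_root_eq_none_iff.2 h').symm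
    have hv' : T.parent v ≠ v := fun h' => hv (parent_eq_self_iff.1 h')
    rw [map_swapTwin_root, map_swapTwin_parent, swapTwin_apply_some_self, insertAbove_root_of_ne hv,
      insertAbove_parent_none_of_ne hv, swapTwin_apply_some_of_ne hv.symm,
      swapTwin_apply_some_of_ne hv']
    exact ⟨rfl, rfl⟩
  · rintro (_ | s) hs -
    · exact absurd rfl (insertAbove_isChild_none_some.1 hs).ne
    · have hsv := hs.ne
      rw [map_swapTwin_parent, swapTwin_apply_some_of_ne (by simpa using hsv), hs.2,
        swapTwin_apply_some_self]
  · rintro (_ | s) h1 h2 hs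
    · exact absurd rfl h1
    · have hsv : s ≠ v := fun h' => h2 (congrArg some h')
      rw [map_swapTwin_parent, swapTwin_apply_some_of_ne hsv, insertAbove_parent_some_of_ne hsv]
      refine swapTwin_apply_some_of_ne fun hp => hs ?_
      have hs' : T.IsChild s v := by
        refine ⟨?_, hp⟩
        rintro rfl
        exact hsv (T.parent_root.symm.trans hp)
      obtain ⟨y, hy, hadj⟩ := hT.exists_adj_of_isChild hs'
      exact ⟨insertAbove_isChild_some_some.2 ⟨hsv, hs'⟩, some y,
        insertAbove_isAncestor_some_some.2 hy, Or.inl hadj⟩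

open Classical in
theorem IsRotation.insertion_eq
    (h : IsRotation (addTrueTwin G v) (T.insertAbove c) (some a) (some b) (T'.insertAbove c')) :
    c' = if c = a then b else c := by
  rw [eq_comm, ← insertAbove_parent_some_eq_none_iff (T := T')]
  split_ifs with hc
  · subst hc
    have h0 : some c ≠ (T.insertAbove c).root := (insertAbove_isChild_some_none.2 rfl).1
    rw [(h.raise_of_not_root h0).2, insertAbove_parent_some_self]
  · have hcb : c ≠ b := by
      rintro rfl
      have := h.isChild.2
      rw [insertAbove_parent_some_self] at this
      exact absurd this (by simp)
    have hp := T.insertAbove_parent_some_self c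
    rw [h.kept (some c) (by simpa using hc) (by simpa using hcb), hp]
    rintro ⟨h1, -⟩
    have := h1.2
    rw [hp] at this
    exact absurd this (by simp)

theorem IsRotation.of_insertAbove (hc : T.IsAncestor c v)
    (h : IsRotation (addTrueTwin G v) (T.insertAbove c) (some a) (some b) (T'.insertAbove c')) :
    IsRotation G T a b T' ∧ c ≠ b := by
  classical
  obtain ⟨hbc, hbT⟩ := insertAbove_isChild_some_some.1 h.isChild
  obtain ⟨hac, haT⟩ := insertAbove_isChild_some_some.1 h.lower
  have hab := hbT.ne.symm
  have heq := h.insertion_eq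
  refine ⟨?_, hbc.symm⟩
  have hmem : ∀ s, s ≠ c → ((T.insertAbove c).IsChild (some s) (some b) ∧
      (∃ y, (T.insertAbove c).IsAncestor (some s) y ∧ (addTrueTwin G v).Adj (some a) y) ↔
      T.IsChild s b ∧ ∃ y, T.IsAncestor s y ∧ G.Adj a y) := by
    intro s hsc
    rw [insertAbove_isChild_some_some, and_iff_right hsc]
    refine and_congr_right fun hs => ?_
    exact insertAbove_exists_adj_iff hc (hs.not_isAncestor_of_isChild hbT)
  have hmem0 : ((T.insertAbove c).IsChild none (some b) ∧
      ∃ y, (T.insertAbove c).IsAncestor none y ∧ (addTrueTwin G v).Adj (some a) y) ↔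
      T.IsChild c b ∧ ∃ y, T.IsAncestor c y ∧ G.Adj a y := by
    rw [insertAbove_isChild_none_some]
    refine and_congr_right fun hs => ?_
    exact insertAbove_none_exists_adj_iff hc (hs.not_isAncestor_of_isChild hbT)
  have hroot : a = T.root → T'.root = b := by
    intro ha
    by_cases hca : c = a
    · have h0 : some a ≠ (T.insertAbove c).root := by
        rw [insertAbove_root_eq_none_iff.2 (hca.trans ha)]
        simp
      have h1 := (h.raise_of_not_root h0).1
      rw [insertAbove_root_eq_none_iff.2 (hca.trans ha), insertAbove_root_eq_none_iff] at h1
      rw [← h1, heq, if_pos hca]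
    · have h0 := h.raise_of_root (insertAbove_root_eq_some_iff.2 ⟨ha ▸ hca, ha⟩).symm
      exact (insertAbove_root_eq_some_iff.1 h0).2.symm
  have hroot' : a ≠ T.root → T'.root = T.root := by
    intro ha
    have h0 : some a ≠ (T.insertAbove c).root :=
      fun h' => ha (insertAbove_root_eq_some_iff.1 h'.symm).2
    have h1 := (h.raise_of_not_root h0).1
    by_cases hc0 : c = T.root
    · rw [insertAbove_root_eq_none_iff.2 hc0, insertAbove_root_eq_none_iff, heq,
        if_neg (fun h' => ha (h'.symm.trans hc0))] at h1
      rw [← h1, hc0]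
    · rw [insertAbove_root_of_ne hc0] at h1
      exact (insertAbove_root_eq_some_iff.1 h1).2.symm
  have hcr : c' = T'.root ↔ c = T.root := by
    rw [heq]
    by_cases ha : a = T.root
    · rw [hroot ha]
      split_ifs with h'
      · simp [h', ha]
      · simp [hbc.symm, ← ha, h']
    · rw [hroot' ha]
      split_ifs with h'
      · simp [h', ha, hbT.1]
      · rfl
  constructor
  · exact hbT
  · exact haT
  · exact hroot
  · intro ha
    refine ⟨hroot' ha, ?_⟩
    have h0 : some a ≠ (T.insertAbove c).root :=
      fun h' => ha (insertAbove_root_eq_some_iff.1 h'.symm).2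
    by_cases hca : c = a
    · have hc0 : c ≠ T.root := hca ▸ ha
      rw [if_pos hca] at heq
      have h3 := h.kept none (by simp) (by simp) fun h' =>
        (hca ▸ (hmem0.1 h').1).not_isAncestor hbT.isAncestor
      rw [insertAbove_parent_none_of_ne hc0, insertAbove_parent_none_of_ne (by rwa [ne_eq, hcr]),
        heq, hca] at h3
      exact Option.some_injective _ h3
    · rw [if_neg hca] at heq
      have h3 := (h.raise_of_not_root h0).2
      rw [insertAbove_parent_some_of_ne (Ne.symm hca),
        insertAbove_parent_some_of_ne (by rwa [heq])] at h3
      exact Option.some_injective _ h3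
  · intro s hs hy
    by_cases hsc : s = c
    · subst hsc
      obtain ⟨h1, h2⟩ := hmem0.2 ⟨hs, hy⟩
      have hsa : s ≠ a := by
        rintro rfl
        exact hs.not_isAncestor hbT.isAncestor
      have h3 := h.moved none h1 h2
      rw [insertAbove_parent_none_of_ne (by rw [ne_eq, hcr]; exact hs.1), heq, if_neg hsa] at h3
      exact Option.some_injective _ h3
    · obtain ⟨h1, h2⟩ := (hmem s hsc).2 ⟨hs, hy⟩
      have hsc' : s ≠ c' := by
        rw [heq]
        split_ifs
        · exact hs.ne
        · exact hsc
      have h3 := h.moved _ h1 h2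
      rw [insertAbove_parent_some_of_ne hsc'] at h3
      exact Option.some_injective _ h3
  · intro s hsa hsb hs
    by_cases hsc : s = c
    · subst hsc
      rw [if_neg hsa] at heq
      by_cases hs0 : s = T.root
      · rw [parent_eq_self_iff.2 (heq ▸ hcr.2 hs0), parent_eq_self_iff.2 hs0]
      · have h3 := h.kept none (by simp) (by simp) (by rwa [hmem0])
        rw [insertAbove_parent_none_of_ne hs0, insertAbove_parent_none_of_ne (by rwa [ne_eq, hcr]),
          heq] at h3
        exact Option.some_injective _ h3
    · have hsc' : s ≠ c' := by
        rw [heq]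
        split_ifs
        · exact hsb
        · exact hsc
      have h3 := h.kept (some s) (by simpa using hsa) (by simpa using hsb) (by rwa [hmem s hsc])
      rw [insertAbove_parent_some_of_ne hsc', insertAbove_parent_some_of_ne hsc] at h3
      exact Option.some_injective _ h3

end TwinRotation

section Insertions

variable {V : Type u} {G : SimpleGraph V} {T T' : RootedTreeOn V} {a b c c' d s v x y : V}
  {i i' : ℕ} {R R' : RootedTreeOn (Option V)}

theorem twinInsertion_zero : twinInsertion T v i 0 = T.insertAbove (T.pathVertex v i) := by
  simp [twinInsertion]

variable (G) in
theorem twinInsertion_one :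
    twinInsertion T v i 1 = (T.insertAbove (T.pathVertex v i)).map (swapTwin G v).toEquiv := by
  simp [twinInsertion, swapTwin]

variable (G) in
theorem twinInsertion_map_swapTwin (j : Fin 2) :
    (twinInsertion T v i j).map (swapTwin G v).toEquiv = twinInsertion T v i j.rev := by
  fin_cases j
  · change (twinInsertion T v i 0).map _ = twinInsertion T v i 1
    rw [twinInsertion_zero, twinInsertion_one G]
  · change (twinInsertion T v i 1).map _ = twinInsertion T v i 0
    rw [twinInsertion_zero, twinInsertion_one G, map_swapTwin_map_swapTwin]

theorem twinInsertion_depth (hc : T.IsAncestor c v) :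
    twinInsertion T v (T.depth c) 0 = T.insertAbove c := by
  rw [twinInsertion_zero, hc.pathVertex_depth]

theorem insertAbove_mem_twinSet (hc : T.IsAncestor c v) : T.insertAbove c ∈ twinSet T v :=
  ⟨_, hc.depth_le, 0, (twinInsertion_depth hc).symm⟩

variable (G) in
theorem map_swapTwin_mem_twinSet (h : R ∈ twinSet T v) :
    R.map (swapTwin G v).toEquiv ∈ twinSet T v := by
  obtain ⟨i, hi, j, rfl⟩ := h
  exact ⟨i, hi, j.rev, twinInsertion_map_swapTwin G j⟩

theorem CrossAdj.map_swapTwin (h : CrossAdj G v T T' R R') :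
    CrossAdj G v T T' (R.map (swapTwin G v).toEquiv) (R'.map (swapTwin G v).toEquiv) := by
  cases h with
  | off_path a b hrot ha hb i hi j =>
    rw [twinInsertion_map_swapTwin, twinInsertion_map_swapTwin]
    exact .off_path a b hrot ha hb i hi _
  | on_path_moved a b hrot ha hb hbv hS i hi hil j =>
    rw [twinInsertion_map_swapTwin, twinInsertion_map_swapTwin]
    exact .on_path_moved a b hrot ha hb hbv hS i hi hil _
  | on_path_kept_above a b hrot ha hb hbv hS i hil j =>
    rw [twinInsertion_map_swapTwin, twinInsertion_map_swapTwin]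
    exact .on_path_kept_above a b hrot ha hb hbv hS i hil _
  | on_path_kept_below a b hrot ha hb hbv hS i hli hi j =>
    rw [twinInsertion_map_swapTwin, twinInsertion_map_swapTwin]
    exact .on_path_kept_below a b hrot ha hb hbv hS i hli hi _
  | at_twin a hrot i hi j =>
    rw [twinInsertion_map_swapTwin, twinInsertion_map_swapTwin]
    exact .at_twin a hrot i hi _

theorem CrossAdj.exists_isRotation (h : CrossAdj G v T T' R R') : ∃ a b, IsRotation G T a b T' := by
  cases h <;> exact ⟨_, _, ‹_›⟩

theorem twinInsertion_isAncestor_iff (j : Fin 2) :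
    (twinInsertion T v i j).IsAncestor none (some v) ↔ j = 0 := by
  have h := T.pathVertex_isAncestor v i
  fin_cases j
  · change (twinInsertion T v i 0).IsAncestor _ _ ↔ (0 : Fin 2) = 0
    rw [twinInsertion_zero, insertAbove_isAncestor_none_some]
    simp [h]
  · change (twinInsertion T v i 1).IsAncestor _ _ ↔ (1 : Fin 2) = 0
    rw [twinInsertion_one ⊥, map_isAncestor_iff, swapTwin_symm_apply, swapTwin_symm_apply,
      swapTwin_apply_none, swapTwin_apply_some_self, insertAbove_isAncestor_some_none]
    simp only [one_ne_zero, iff_false, not_and]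
    exact fun h1 h2 => h1 (h2.antisymm h)

theorem twinInsertion_injective {j j' : Fin 2}
    (h : twinInsertion T v i j = twinInsertion T' v i' j') : T = T' := by
  have hj : j = 0 ↔ j' = 0 := by
    rw [← twinInsertion_isAncestor_iff (T := T) (v := v) (i := i), h, twinInsertion_isAncestor_iff]
  obtain rfl : j = j' := by omega
  have key : twinInsertion T v i 0 = twinInsertion T' v i' 0 := by
    obtain rfl | rfl : j = 0 ∨ j = 1 := by omega
    · exact h
    · have := congrArg (RootedTreeOn.map (swapTwin ⊥ v).toEquiv) h
      rwa [twinInsertion_map_swapTwin, twinInsertion_map_swapTwin] at this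
  rw [twinInsertion_zero, twinInsertion_zero] at key
  exact (insertAbove_injective key).1

theorem IsLocalSearchTree.twinInsertion (hT : IsLocalSearchTree G T) (i : ℕ) (j : Fin 2) :
    IsLocalSearchTree (addTrueTwin G v) (twinInsertion T v i j) := by
  have h := hT.insertAbove (T.pathVertex_isAncestor v i)
  obtain rfl | rfl : j = 0 ∨ j = 1 := by omega
  · rwa [twinInsertion_zero]
  · rw [twinInsertion_one G]
    exact h.map _

theorem IsLocalSearchTree.isAncestor_twin_or (hR : IsLocalSearchTree (addTrueTwin G v) R) :
    R.IsAncestor none (some v) ∨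
      (R.map (swapTwin G v).toEquiv).IsAncestor none (some v) := by
  rw [map_isAncestor_iff, swapTwin_symm_apply, swapTwin_symm_apply,
      swapTwin_apply_none, swapTwin_apply_some_self]
  exact hR.comparable none (some v) (Or.inr rfl)

theorem IsLocalSearchTree.exists_mem_twinSet (hR : IsLocalSearchTree (addTrueTwin G v) R) :
    ∃ T, IsLocalSearchTree G T ∧ R ∈ twinSet T v := by
  rcases hR.isAncestor_twin_or with h | h
  · obtain ⟨T, c, rfl, hc, hT⟩ := hR.exists_eq_insertAbove h
    exact ⟨T, hT, insertAbove_mem_twinSet hc⟩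
  · obtain ⟨T, c, h, hc, hT⟩ := (hR.map (swapTwin G v)).exists_eq_insertAbove h
    refine ⟨T, hT, ?_⟩
    have := map_swapTwin_mem_twinSet G (insertAbove_mem_twinSet hc)
    rwa [← h, map_swapTwin_map_swapTwin] at this

end Insertions

section CrossEdges

variable {V : Type u} {G : SimpleGraph V} {T T' : RootedTreeOn V} {a b c c' d s v x y : V}
  {i i' : ℕ} {R R' : RootedTreeOn (Option V)}

namespace IsRotation

open Classical in
theorem isAncestor_ite (h : IsRotation G T a b T') (hc : T.IsAncestor c v) (hcb : c ≠ b) :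
    T'.IsAncestor (if c = a then b else c) v := by
  split_ifs with hca
  · exact h.isAncestor_raised_iff.2 (hca ▸ hc)
  · exact (h.isAncestor_iff hca hcb).2 hc

theorem depth_of_not_isAncestor [Finite V] (h : IsRotation G T a b T') (ha : ¬ T.IsAncestor a v)
    (hc : T.IsAncestor c v) : T'.depth c = T.depth c := by
  classical
  have h1 : ¬ T.IsAncestor b c := fun h1 => ha ((h.isChild.isAncestor.trans h1).trans hc)
  have h2 : ¬ T'.IsAncestor a c := fun h2 =>
    ha ((h.isAncestor_raised_iff.1 (h.lower.isAncestor.trans h2)).trans hc)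
  simpa [h1, h2] using h.depth_add c

open Classical in
theorem depth_ite_of_lt [Finite V] (h : IsRotation G T a b T') (ha : T.IsAncestor a v)
    (hc : T.IsAncestor c v) (hlt : T.depth c < T.depth b) :
    T'.depth (if c = a then b else c) = T.depth c := by
  have hd := h.isChild.depth
  split_ifs with hca
  · have := h.depth_add b
    rw [if_pos (T.isAncestor_refl b), if_neg h.lower.not_isAncestor] at this
    rw [hca]
    omega
  · have hca' : T.IsAncestor c a := hc.of_depth_le ha (by omega)
    have h1 : ¬ T.IsAncestor b c := fun h1 => h.isChild.not_isAncestor (h1.trans hca')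
    have h2 : ¬ T'.IsAncestor a c := fun h2 =>
      hca (hca'.antisymm (h.isAncestor_raised_iff.1 (h.lower.isAncestor.trans h2)))
    simpa [h1, h2] using h.depth_add c

theorem depth_of_moved [Finite V] (h : IsRotation G T a b T') (hb : T.IsAncestor b v)
    (hc : T.IsAncestor c v) (hlt : T.depth b < T.depth c)
    (hS : ∃ y, T.IsAncestor (T.pathVertex v (T.depth b + 1)) y ∧ G.Adj a y) :
    T'.depth c = T.depth c := by
  classical
  have hbc : T.IsAncestor b c := hb.of_depth_le hc hlt.le
  obtain ⟨s, hs, hsc⟩ := hbc.exists_isChild (by rintro rfl; exact hlt.false)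
  rw [hs.eq_pathVertex (hsc.trans hc)] at hS
  have hsa : s ≠ a := by
    rintro rfl
    exact hs.not_isAncestor h.isChild.isAncestor
  have h1 : T'.IsAncestor a s := h.moved s hs hS ▸ T'.isAncestor_parent s
  have h2 : T'.IsAncestor a c := h1.trans ((h.isAncestor_iff hsa hs.ne).2 hsc)
  simpa [hbc, h2] using h.depth_add c

theorem depth_of_kept [Finite V] (h : IsRotation G T a b T') (hb : T.IsAncestor b v)
    (hc : T.IsAncestor c v) (hlt : T.depth b < T.depth c)
    (hS : ¬ ∃ y, T.IsAncestor (T.pathVertex v (T.depth b + 1)) y ∧ G.Adj a y) :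
    T'.depth c + 1 = T.depth c := by
  classical
  have hbc : T.IsAncestor b c := hb.of_depth_le hc hlt.le
  obtain ⟨s, hs, hsc⟩ := hbc.exists_isChild (by rintro rfl; exact hlt.false)
  rw [hs.eq_pathVertex (hsc.trans hc)] at hS
  have hsa : s ≠ a := by
    rintro rfl
    exact hs.not_isAncestor h.isChild.isAncestor
  have h1 : T'.parent s = b := by
    rw [h.kept s hsa hs.ne fun h' => hS h'.2, hs.2]
  have h2 : ¬ T'.IsAncestor a c := by
    intro h2
    rcases h2.total ((h.isAncestor_iff hsa hs.ne).2 hsc) with h3 | h3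
    · have := isAncestor_parent_of_ne h3 hsa.symm
      rw [h1] at this
      exact h.lower.not_isAncestor this
    · rw [h.isAncestor_iff hsa hs.ne] at h3
      exact hs.not_isAncestor (h3.trans h.isChild.isAncestor)
  simpa [hbc, h2] using h.depth_add c

theorem isAncestor_lowered (h : IsRotation G T a b T') (ha : T.IsAncestor a v)
    (hb : ¬ T.IsAncestor b v) : T'.IsAncestor a v := by
  by_cases hav : a = v
  · exact hav ▸ T'.isAncestor_refl a
  obtain ⟨s, hs, hsv⟩ := ha.exists_isChild hav
  have hsb : s ≠ b := fun h' => hb (h' ▸ hsv)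
  have hp : T'.parent s = a := by
    rw [h.kept s hs.ne hsb fun h' => h.ne (hs.2.symm.trans h'.1.2), hs.2]
  have : T'.IsAncestor a s := hp ▸ T'.isAncestor_parent s
  exact this.trans ((h.isAncestor_iff hs.ne hsb).2 hsv)

open Classical in
theorem exists_isRotation_twinInsertion (h : IsRotation G T a b T') (hcb : T.pathVertex v i ≠ b)
    (hi' : T'.depth (if T.pathVertex v i = a then b else T.pathVertex v i) = i') (j : Fin 2) :
    ∃ x y, IsRotation (addTrueTwin G v) (twinInsertion T v i j) x y (twinInsertion T' v i' j) := by
  have hc := T.pathVertex_isAncestor v i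
  have h0 := h.insertAbove hc hcb
  rw [← twinInsertion_depth (h.isAncestor_ite hc hcb), hi', ← twinInsertion_zero] at h0
  obtain rfl | rfl : j = 0 ∨ j = 1 := by omega
  · exact ⟨_, _, h0⟩
  · have := h0.map (swapTwin G v)
    rw [twinInsertion_map_swapTwin, twinInsertion_map_swapTwin] at this
    exact ⟨_, _, this⟩

open Classical in
theorem crossAdj [Finite V] (h : IsRotation G T a b T') (hc : T.IsAncestor c v) (hcb : c ≠ b)
    (hab : T.IsAncestor a v → T.IsAncestor b v) :
    CrossAdj G v T T' (T.insertAbove c) (T'.insertAbove (if c = a then b else c)) := by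
  have hc' := h.isAncestor_ite hc hcb
  rw [← twinInsertion_depth hc, ← twinInsertion_depth hc']
  by_cases ha : T.IsAncestor a v
  · have hb := hab ha
    rcases lt_trichotomy (T.depth c) (T.depth b) with hlt | heq | hlt
    · rw [h.depth_ite_of_lt ha hc hlt]
      by_cases hbv : b = v
      · subst hbv
        exact .at_twin a h _ hlt 0
      · by_cases hS : ∃ y, T.IsAncestor (T.pathVertex v (T.depth b + 1)) y ∧ G.Adj a y
        · exact .on_path_moved a b h ha hb hbv hS _ hc.depth_le hlt.ne 0
        · exact .on_path_kept_above a b h ha hb hbv hS _ hlt 0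
    · exact absurd ((hc.of_depth_le hb heq.le).eq_of_depth_le heq.ge) hcb
    · have hbv : b ≠ v := by
        rintro rfl
        exact absurd hc.depth_le (by omega)
      have hca : c ≠ a := by
        rintro rfl
        have := h.isChild.depth
        omega
      rw [if_neg hca]
      by_cases hS : ∃ y, T.IsAncestor (T.pathVertex v (T.depth b + 1)) y ∧ G.Adj a y
      · rw [h.depth_of_moved hb hc hlt hS]
        exact .on_path_moved a b h ha hb hbv hS _ hc.depth_le hlt.ne' 0
      · have hd := h.depth_of_kept hb hc hlt hS
        have := hc.depth_le
        rw [← hd]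
        exact .on_path_kept_below a b h ha hb hbv hS _ (by omega) (by omega) 0
  · have hb : ¬ T.IsAncestor b v := fun hb => ha (h.isChild.isAncestor.trans hb)
    have hca : c ≠ a := by
      rintro rfl
      exact ha hc
    rw [if_neg hca, h.depth_of_not_isAncestor ha hc]
    exact .off_path a b h ha hb _ hc.depth_le 0

open Classical in
theorem crossAdj_or [Finite V] (hT : IsLocalSearchTree G T) (h : IsRotation G T a b T')
    (hc : T.IsAncestor c v) (hcb : c ≠ b) :
    CrossAdj G v T T' (T.insertAbove c) (T'.insertAbove (if c = a then b else c)) ∨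
      CrossAdj G v T' T (T'.insertAbove (if c = a then b else c)) (T.insertAbove c) := by
  by_cases hab : T.IsAncestor a v → T.IsAncestor b v
  · exact Or.inl (h.crossAdj hc hcb hab)
  · obtain ⟨ha, hb⟩ := Classical.not_imp.1 hab
    have hca : (if c = a then b else c) ≠ a := by
      split_ifs with h'
      · exact h.ne.symm
      · exact h'
    have := (h.symm hT).crossAdj (h.isAncestor_ite hc hcb) hca
      fun _ => h.isAncestor_lowered ha hb
    have heq : (if (if c = a then b else c) = b then a else (if c = a then b else c)) = c := by
      by_cases h' : c = a
      · simp [h']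
      · simp [h', hcb]
    rw [heq] at this
    exact Or.inr this

end IsRotation

theorem CrossAdj.exists_isRotation_twin [Finite V] (h : CrossAdj G v T T' R R') :
    ∃ x y, IsRotation (addTrueTwin G v) R x y R' := by
  classical
  have hpv : ∀ {i b}, i ≤ T.depth v → T.pathVertex v i = b → T.depth b = i := by
    rintro i b hi rfl
    exact depth_pathVertex hi
  have hA := T.pathVertex_isAncestor v
  cases h with
  | off_path a b hrot ha hb i hi j =>
    refine hrot.exists_isRotation_twinInsertion (fun h' => hb (h' ▸ hA i)) ?_ j
    rw [if_neg (by rintro rfl; exact ha (hA i)), hrot.depth_of_not_isAncestor ha (hA i),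
      depth_pathVertex hi]
  | on_path_moved a b hrot ha hb hbv hS i hi hil j =>
    have hd := depth_pathVertex hi
    refine hrot.exists_isRotation_twinInsertion (fun h' => hil (hpv hi h').symm) ?_ j
    rcases lt_or_gt_of_ne hil with hlt | hlt
    · rw [hrot.depth_ite_of_lt ha (hA i) (by omega), hd]
    · rw [if_neg, hrot.depth_of_moved hb (hA i) (by omega) hS, hd]
      intro h'
      have := hpv hi h'
      have := hrot.isChild.depth
      omega
  | on_path_kept_above a b hrot ha hb hbv hS i hil j =>
    have hi : i ≤ T.depth v := hil.le.trans hb.depth_le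
    have hd := depth_pathVertex hi
    refine hrot.exists_isRotation_twinInsertion (fun h' => hil.ne (hpv hi h').symm) ?_ j
    rw [hrot.depth_ite_of_lt ha (hA i) (by omega), hd]
  | on_path_kept_below a b hrot ha hb hbv hS i hli hi j =>
    have hd := depth_pathVertex (T := T) (v := v) (i := i + 1) hi
    refine hrot.exists_isRotation_twinInsertion (fun h' => ?_) ?_ j
    · have := hpv hi h'
      omega
    · have h1 := hrot.depth_of_kept hb (hA (i + 1)) (by omega) hS
      rw [if_neg]
      · omega
      · intro h'
        have := hpv hi h'
        have := hrot.isChild.depth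
        omega
  | at_twin a hrot i hi j =>
    have hd := depth_pathVertex hi.le
    refine hrot.exists_isRotation_twinInsertion (fun h' => hi.ne (hpv hi.le h').symm) ?_ j
    rw [hrot.depth_ite_of_lt hrot.isChild.isAncestor (hA i) (by omega), hd]

/-- The classification of the edges of the rotation graph of `G_v`. -/
def TwinEdge (G : SimpleGraph V) (v : V) (R R' : RootedTreeOn (Option V)) : Prop :=
  (∃ T, IsLocalSearchTree G T ∧ R ∈ twinSet T v ∧ R' ∈ twinSet T v) ∨
    ∃ T T', IsLocalSearchTree G T ∧ IsLocalSearchTree G T' ∧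
      (CrossAdj G v T T' R R' ∨ CrossAdj G v T' T R' R)

theorem TwinEdge.map_swapTwin (h : TwinEdge G v R R') :
    TwinEdge G v (R.map (swapTwin G v).toEquiv) (R'.map (swapTwin G v).toEquiv) := by
  rcases h with ⟨T, hT, h, h'⟩ | ⟨T, T', hT, hT', h⟩
  · exact Or.inl ⟨T, hT, map_swapTwin_mem_twinSet G h, map_swapTwin_mem_twinSet G h'⟩
  · exact Or.inr ⟨T, T', hT, hT', h.imp CrossAdj.map_swapTwin CrossAdj.map_swapTwin⟩

theorem IsRotation.exists_mem_twinSet {z : Option V}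
    (h : IsRotation (addTrueTwin G v) R none z R')
    (hR : IsLocalSearchTree (addTrueTwin G v) R) (hv : R.IsAncestor none (some v)) :
    ∃ T, IsLocalSearchTree G T ∧ R ∈ twinSet T v ∧ R' ∈ twinSet T v := by
  obtain ⟨T, c, rfl, hc, hT⟩ := hR.exists_eq_insertAbove hv
  refine ⟨T, hT, insertAbove_mem_twinSet hc, ?_⟩
  obtain _ | b := z
  · exact absurd rfl h.ne
  obtain rfl := insertAbove_isChild_some_none.1 h.isChild
  by_cases hbv : b = v
  · subst hbv
    rw [h.unique (isRotation_insertAbove_self hT)]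
    exact map_swapTwin_mem_twinSet G (insertAbove_mem_twinSet hc)
  · obtain ⟨d, hd, hdv⟩ := hc.exists_isChild hbv
    rw [h.unique (isRotation_insertAbove_of_isChild hT hd hdv)]
    exact insertAbove_mem_twinSet hdv

theorem IsRotation.twinEdge_of_isAncestor [Finite V] {x y : Option V}
    (h : IsRotation (addTrueTwin G v) R x y R') (hR : IsLocalSearchTree (addTrueTwin G v) R)
    (hR' : IsLocalSearchTree (addTrueTwin G v) R') (hv : R.IsAncestor none (some v)) :
    TwinEdge G v R R' := by
  classical
  obtain _ | a := x
  · exact Or.inl (h.exists_mem_twinSet hR hv)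
  obtain _ | b := y
  · obtain ⟨T, hT, h1, h2⟩ := (h.symm hR).exists_mem_twinSet hR'
      (h.isAncestor_raised_iff.2 (h.isChild.isAncestor.trans hv))
    exact Or.inl ⟨T, hT, h2, h1⟩
  · have hv' := (h.isAncestor_iff (by simp) (by simp)).2 hv
    obtain ⟨T, c, rfl, hc, hT⟩ := hR.exists_eq_insertAbove hv
    obtain ⟨T', c', rfl, hc', hT'⟩ := hR'.exists_eq_insertAbove hv'
    obtain ⟨h1, hcb⟩ := h.of_insertAbove hc
    rw [h.insertion_eq]
    exact Or.inr ⟨T, T', hT, hT', h1.crossAdj_or hT hc hcb⟩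

theorem IsRotation.twinEdge [Finite V] {x y : Option V}
    (h : IsRotation (addTrueTwin G v) R x y R') (hR : IsLocalSearchTree (addTrueTwin G v) R)
    (hR' : IsLocalSearchTree (addTrueTwin G v) R') : TwinEdge G v R R' := by
  rcases hR.isAncestor_twin_or with hv | hv
  · exact h.twinEdge_of_isAncestor hR hR' hv
  · have := ((h.map (swapTwin G v)).twinEdge_of_isAncestor (hR.map _) (hR'.map _) hv).map_swapTwin
    rwa [map_swapTwin_map_swapTwin, map_swapTwin_map_swapTwin] at this

end CrossEdges

section Path

variable {V : Type u} {G : SimpleGraph V} {T : RootedTreeOn V} {v : V} {n m : ℕ}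

variable (T v n) in
/-- The `n`-th tree `T(0, 1), …, T(k, 1), T(k, 2), …, T(0, 2)` on the path on `P(T)`. -/
noncomputable def twinPath : RootedTreeOn (Option V) :=
  if n ≤ T.depth v then twinInsertion T v n 0 else twinInsertion T v (2 * T.depth v + 1 - n) 1

theorem twinPath_mem (hn : n < 2 * (T.depth v + 1)) : twinPath T v n ∈ twinSet T v := by
  rw [twinPath]
  split_ifs with h
  · exact ⟨n, h, 0, rfl⟩
  · exact ⟨_, by omega, 1, rfl⟩

theorem exists_twinPath_eq {R : RootedTreeOn (Option V)} (h : R ∈ twinSet T v) :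
    ∃ n < 2 * (T.depth v + 1), twinPath T v n = R := by
  obtain ⟨i, hi, j, rfl⟩ := h
  obtain rfl | rfl : j = 0 ∨ j = 1 := by omega
  · exact ⟨i, by omega, if_pos hi⟩
  · refine ⟨2 * T.depth v + 1 - i, by omega, ?_⟩
    rw [twinPath, if_neg (by omega), Nat.sub_sub_self (by omega)]

theorem twinPath_depth (hn : n < 2 * (T.depth v + 1)) :
    (n ≤ T.depth v ∧ (twinPath T v n).depth none = n ∧
      (twinPath T v n).depth (some v) = T.depth v + 1) ∨
    (T.depth v < n ∧ (twinPath T v n).depth none = T.depth v + 1 ∧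
      (twinPath T v n).depth (some v) + n = 2 * T.depth v + 1) := by
  have key : ∀ i ≤ T.depth v, (T.insertAbove (T.pathVertex v i)).depth none = i ∧
      (T.insertAbove (T.pathVertex v i)).depth (some v) = T.depth v + 1 := by
    intro i hi
    rw [insertAbove_depth_none, insertAbove_depth_some (T.pathVertex_isAncestor v i),
      depth_pathVertex hi]
    exact ⟨rfl, rfl⟩
  rw [twinPath]
  split_ifs with h
  · rw [twinInsertion_zero]
    exact Or.inl ⟨h, key n h⟩
  · obtain ⟨h1, h2⟩ := key (2 * T.depth v + 1 - n) (by omega)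
    rw [twinInsertion_one ⊥, map_depth, map_depth, swapTwin_symm_apply, swapTwin_symm_apply,
      swapTwin_apply_none, swapTwin_apply_some_self, h1, h2]
    omega

theorem twinPath_injective (hn : n < 2 * (T.depth v + 1)) (hm : m < 2 * (T.depth v + 1))
    (h : twinPath T v n = twinPath T v m) : n = m := by
  have h1 := twinPath_depth hn
  have h2 := twinPath_depth hm
  rw [h] at h1
  omega

theorem twinPath_adj_of_isRotation [Finite V] {x y : Option V} (hn : n < 2 * (T.depth v + 1))
    (hm : m < 2 * (T.depth v + 1))
    (h : IsRotation (addTrueTwin G v) (twinPath T v n) x y (twinPath T v m)) :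
    n + 1 = m ∨ m + 1 = n := by
  have h1 := twinPath_depth hn
  have h2 := twinPath_depth hm
  have h3 := h.depth_le none
  have h4 := h.depth_le (some v)
  have h5 : n ≠ m := by
    rintro rfl
    exact h.tree_ne rfl
  omega

theorem isRotation_twinInsertion_succ (hT : IsLocalSearchTree G T) {i : ℕ} (hi : i < T.depth v) :
    ∃ x y, IsRotation (addTrueTwin G v) (twinInsertion T v i 0) x y
      (twinInsertion T v (i + 1) 0) := by
  have hd := depth_pathVertex hi.le
  have hA := T.pathVertex_isAncestor v i
  obtain ⟨s, hs, hsv⟩ := hA.exists_isChild (by rintro h; rw [h] at hd; omega)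
  have := hs.eq_pathVertex hsv
  rw [hd] at this
  rw [twinInsertion_zero, twinInsertion_zero, this]
  exact ⟨_, _, isRotation_insertAbove_of_isChild hT hs hsv⟩

theorem exists_isRotation_twinPath_succ (hT : IsLocalSearchTree G T)
    (hn : n + 1 < 2 * (T.depth v + 1)) :
    (∃ x y, IsRotation (addTrueTwin G v) (twinPath T v n) x y (twinPath T v (n + 1))) ∨
      ∃ x y, IsRotation (addTrueTwin G v) (twinPath T v (n + 1)) x y (twinPath T v n) := by
  rcases lt_trichotomy n (T.depth v) with h | rfl | h
  · left
    rw [twinPath, twinPath, if_pos h.le, if_pos (Nat.succ_le_of_lt h)]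
    exact isRotation_twinInsertion_succ hT h
  · left
    rw [twinPath, twinPath, if_pos le_rfl, if_neg (by omega),
      show 2 * T.depth v + 1 - (T.depth v + 1) = T.depth v by omega, twinInsertion_one G,
      twinInsertion_depth (T.isAncestor_refl v), (T.isAncestor_refl v).pathVertex_depth]
    exact ⟨_, _, isRotation_insertAbove_self hT⟩
  · right
    obtain ⟨x, y, hxy⟩ := isRotation_twinInsertion_succ (v := v) hT
      (i := 2 * T.depth v + 1 - (n + 1)) (by omega)
    have := hxy.map (swapTwin G v)
    rw [twinInsertion_map_swapTwin, twinInsertion_map_swapTwin] at this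
    rw [twinPath, twinPath, if_neg (by omega), if_neg (by omega),
      show 2 * T.depth v + 1 - n = 2 * T.depth v + 1 - (n + 1) + 1 by omega]
    exact ⟨_, _, this⟩

theorem nonempty_induce_twinSet_iso [Finite V] (hG : G.Connected) (hT : IsLocalSearchTree G T) :
    Nonempty ((rotationGraph (addTrueTwin G v)).induce {R | R.1 ∈ twinSet T v} ≃g
      SimpleGraph.pathGraph (2 * (T.depth v + 1))) := by
  have hst : ∀ R ∈ twinSet T v, IsSearchTree (addTrueTwin G v) R := by
    rintro R ⟨i, -, j, rfl⟩
    exact (hT.twinInsertion i j).isSearchTree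
  let f : Fin (2 * (T.depth v + 1)) →
      {R : SearchTree (addTrueTwin G v) | R.1 ∈ twinSet T v} :=
    fun n => ⟨⟨twinPath T v n, hst _ (twinPath_mem n.2)⟩, twinPath_mem n.2⟩
  have hf : Function.Bijective f := by
    constructor
    · intro n m h
      exact Fin.ext (twinPath_injective n.2 m.2 (congrArg (fun R => R.1.1) h))
    · rintro ⟨⟨R, hR⟩, h⟩
      obtain ⟨n, hn, rfl⟩ := exists_twinPath_eq h
      exact ⟨⟨n, hn⟩, rfl⟩
  refine ⟨SimpleGraph.Iso.symm ⟨Equiv.ofBijective f hf, ?_⟩⟩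
  intro n m
  have key : ∀ n m, ((rotationGraph (addTrueTwin G v)).induce _).Adj (f n) (f m) ↔
      ∃ x y, IsRotation (addTrueTwin G v) (twinPath T v n) x y (twinPath T v m) :=
    fun n m => rotationGraph_adj_iff (addTrueTwin_connected hG)
  change ((rotationGraph (addTrueTwin G v)).induce _).Adj (f n) (f m) ↔ _
  rw [SimpleGraph.pathGraph_adj]
  constructor
  · rw [key]
    rintro ⟨x, y, h⟩
    exact twinPath_adj_of_isRotation n.2 m.2 h
  · have hsucc : ∀ n m : Fin (2 * (T.depth v + 1)), n.val + 1 = m.val →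
        ((rotationGraph (addTrueTwin G v)).induce _).Adj (f n) (f m) := by
      intro n m h
      have := exists_isRotation_twinPath_succ (v := v) hT (n := n) (by omega)
      rw [h, ← key, ← key] at this
      exact this.elim id SimpleGraph.Adj.symm
    rintro (h | h)
    · exact hsucc n m h
    · exact (hsucc m n h).symm

end Path

theorem mainTheorem9 {V : Type*} [Finite V] (G : SimpleGraph V) (hG : G.Connected) (v : V) :
    -- the sets `P(T)` form a partition of the vertex set of the rotation graph of `G_v`
    ((∀ T : SearchTree G, (twinSet T.1 v).Nonempty) ∧
      (∀ T T' : SearchTree G, T ≠ T' → Disjoint (twinSet T.1 v) (twinSet T'.1 v)) ∧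
      (⋃ T : SearchTree G, twinSet T.1 v) = {R | IsSearchTree (addTrueTwin G v) R}) ∧
    -- each `P(T)` induces a path
    (∀ T : SearchTree G,
      Nonempty ((rotationGraph (addTrueTwin G v)).induce {R | R.1 ∈ twinSet T.1 v} ≃g
        SimpleGraph.pathGraph (2 * (T.1.depth v + 1)))) ∧
    -- the edges of the rotation graph of `G_v`
    (rotationGraph (addTrueTwin G v)).edgeSet =
      (⋃ T : SearchTree G, twinSetEdges G v T.1) ∪
        ⋃ e ∈ (rotationGraph G).edgeSet, crossEdges G v e := by
  have hGv : (addTrueTwin G v).Connected := addTrueTwin_connected hG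
  refine ⟨⟨?_, ?_, ?_⟩, ?_, ?_⟩
  · exact fun T => ⟨_, 0, Nat.zero_le _, 0, rfl⟩
  · intro T T' hne
    rw [Set.disjoint_left]
    rintro R ⟨i, -, j, rfl⟩ ⟨i', -, j', h⟩
    exact hne (Subtype.ext (twinInsertion_injective h))
  · ext R
    simp only [Set.mem_iUnion, Set.mem_ofPred_eq]
    constructor
    · rintro ⟨T, i, -, j, rfl⟩
      exact ((T.2.isLocalSearchTree hG).twinInsertion i j).isSearchTree
    · intro hR
      obtain ⟨T, hT, h⟩ := (hR.isLocalSearchTree hGv).exists_mem_twinSet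
      exact ⟨⟨T, hT.isSearchTree⟩, h⟩
  · exact fun T => nonempty_induce_twinSet_iso hG (T.2.isLocalSearchTree hG)
  · have hcross : ∀ {T T' : SearchTree G} {R R' : SearchTree (addTrueTwin G v)},
        CrossAdj G v T.1 T'.1 R.1 R'.1 →
          s(R, R') ∈ ⋃ e ∈ (rotationGraph G).edgeSet, crossEdges G v e := by
      intro T T' R R' h
      simp only [Set.mem_iUnion]
      exact ⟨s(T, T'), (rotationGraph_adj_iff hG).2 h.exists_isRotation, T, T', rfl, R, R', rfl, h⟩
    ext f
    constructor
    · intro hf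
      induction f using Sym2.ind with
      | _ R R' =>
        obtain ⟨x, y, h⟩ := (rotationGraph_adj_iff hGv).1 hf
        rcases h.twinEdge (R.2.isLocalSearchTree hGv) (R'.2.isLocalSearchTree hGv) with
          ⟨T, hT, h1, h2⟩ | ⟨T, T', hT, hT', h1 | h1⟩
        · refine Or.inl (Set.mem_iUnion.2 ⟨⟨T, hT.isSearchTree⟩, hf, ?_⟩)
          intro U hU
          rcases Sym2.mem_iff.1 hU with rfl | rfl
          · exact h1
          · exact h2
        · exact Or.inr (hcross (T := ⟨T, hT.isSearchTree⟩) (T' := ⟨T', hT'.isSearchTree⟩) h1)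
        · rw [Sym2.eq_swap]
          exact Or.inr (hcross (T := ⟨T', hT'.isSearchTree⟩) (T' := ⟨T, hT.isSearchTree⟩) h1)
    · rintro (hf | hf)
      · obtain ⟨T, hf⟩ := Set.mem_iUnion.1 hf
        exact hf.1
      · simp only [Set.mem_iUnion] at hf
        obtain ⟨e, -, T, T', -, R, R', rfl, h⟩ := hf
        exact (rotationGraph_adj_iff hGv).2 h.exists_isRotation_twin
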